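/- Let $n\ge 0$, let $\eta=\mathrm{diag}(+,-,\dots,-,+)$ on $\mathbb{R}^{n+2}$ (coordinates $y^0,\dots,y^{n+1}$), $c(y)=\tfrac12\eta(y,y)$, and let $D=y^\alpha\partial_\alpha$ be the dilation field. Let $f$ be a smooth function on an open set $\Omega\subseteq\mathbb{R}^{n+2}$ stable under multiplication by positive scalars, homogeneous of degree one: $f(ty)=tf(y)$ for $y\in\Omega$, $t>0$. Put $F=\sharp_\eta df$, $\mathbf F^2=\eta(F,F)$, $E_f=fF-\mathbf F^2D$, and $$X_f=\{y\in\Omega : c(y)=0,\ f(y)=1\},$$ an $n$-dimensional submanifold (possibly empty) with inclusion $m_f$ and tangent spaces $T_yX_f=\ker dc_y\cap\ker df_y$, so that $\mathbb{R}^{n+2}=T_yX_f\oplus\mathrm{span}(F,D)$ for $y\in X_f$. Forms are smooth; $\Omega^a$ denotes forms of degree $a$. A form $\hat\beta$ on an open $U\subseteq\Omega$ is called an extension of a form $\beta$ on $X_f\cap U$ if $\hat\beta|_{X_f\cap U}=\beta$, where $\beta$ is identified with the form along $X_f$ that vanishes as soon as one argument is $D$ or $F$; that is, $m_f^*\hat\beta=\beta$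 and $i_D\hat\beta=i_F\hat\beta=0$ at the points of $X_f\cap U$. Let $V$ be either of the vector fields $E_f$ and $F$. (1) Every point of $X_f$ has arbitrarily small open neighbourhoods $U\subseteq\Omega$ such that for all $a\in\mathbb{N}$ and $r\in\mathbb{R}$: - every $\beta\in\Omega^a(X_f\cap U)$ has a unique extension $\hat\beta\in\Omega^a(U)$ with $\mathcal{L}_D\hat\beta=r\hat\beta$ and $\mathcal{L}_V\hat\beta=0$ on $U$, and this extension is transverse on $U$: $i_D\hat\beta=i_F\hat\beta=0$ on $U$; - $m_f^*$ is a bijection from $\{\alpha\in\Omega^a(U) : i_D\alpha=i_F\alpha=0,\ \mathcal{L}_D\alpha=r\alpha,\ \mathcal{L}_V\alpha=0\}$ onto $\Omega^a(X_f\cap U)$. (For $V=F$ the elements of this set are the strongly transverse forms of degree $r$ on $U$.) (2) For all $a$ and $r$, every $\beta\in\Omega^a(X_f)$ has, on some open neighbourhood $W\subseteq\Omega$ of the whole of $X_f$, an extension $\hat\beta\in\Omega^a(W)$ with $i_D\hat\beta=i_F\hat\beta=0$, $\mathcal{L}_D\hat\beta=r\hat\beta$ and $\mathcal{L}_V\hat\beta=0$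 on $W$; and any two extensions of $\beta$ to open neighbourhoods of $X_f$ in $\Omega$ that satisfy $\mathcal{L}_D\hat\beta=r\hat\beta$ and $\mathcal{L}_V\hat\beta=0$ coincide on a smaller open neighbourhood of $X_f$. Hence $m_f^*$ is a bijection from germs along $X_f$ of the forms described in (1) onto $\Omega^a(X_f)$. -/

import Mathlib

open Set Filter Topology
open scoped ContDiff

noncomputable section

namespace NullConeForms

/-- The ambient vector space `ℝ^{n+2}`, with coordinates `y⁰, …, y^{n+1}`. -/
abbrev Ambient (n : ℕ) : Type := Fin (n + 2) → ℝ

/-- The diagonal entries of the metric `η = diag(+, -, …, -, +)`. -/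
def etaSign (n : ℕ) (α : Fin (n + 2)) : ℝ :=
  if α = 0 ∨ α = Fin.last (n + 1) then 1 else -1

/-- The ambient pseudo-Euclidean metric `η`. -/
def eta {n : ℕ} (u v : Ambient n) : ℝ := ∑ α, etaSign n α * u α * v α

/-- `c(y) = η(y, y) / 2`, whose zero set is the null cone. -/
def cone {n : ℕ} (y : Ambient n) : ℝ := (1 / 2) * eta y y

/-- The dilation vector field `D = y^α ∂_α`. -/
def dilation {n : ℕ} (y : Ambient n) : Ambient n := y

/-- The `η`-gradient `♯_η dg`, with components `η^{αα} ∂_α g`. -/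
def gradient {n : ℕ} (g : Ambient n → ℝ) (y : Ambient n) : Ambient n :=
  fun α => etaSign n α * fderiv ℝ g y (Pi.single α 1)

/-- A smooth function, homogeneous of degree `1`, on an open subset of `ℝ^{n+2}` that is stable
under multiplication by positive scalars. The values outside the domain are irrelevant. -/
structure DefiningFunction (n : ℕ) where
  toFun : Ambient n → ℝ
  domain : Set (Ambient n)
  isOpen_domain : IsOpen domain
  smul_mem : ∀ y ∈ domain, ∀ t : ℝ, 0 < t → t • y ∈ domain
  smooth : ContDiffOn ℝ ∞ toFun domain
  homogeneous : ∀ y ∈ domain, ∀ t : ℝ, 0 < t → toFun (t • y) = t * toFun y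

variable {n : ℕ}

namespace DefiningFunction

/-- The submanifold `X_f = {c = 0} ∩ {f = 1}`. -/
def X (f : DefiningFunction n) : Set (Ambient n) :=
  {y | y ∈ f.domain ∧ cone y = 0 ∧ f.toFun y = 1}

/-- The tangent space `T_y X_f = ker dc_y ∩ ker df_y`, as a subspace of `ℝ^{n+2}`. -/
def tangent (f : DefiningFunction n) (y : Ambient n) : Submodule ℝ (Ambient n) :=
  LinearMap.ker (fderiv ℝ (cone (n := n)) y).toLinearMap ⊓
    LinearMap.ker (fderiv ℝ f.toFun y).toLinearMap

/-- The vector field `F = ♯_η df`. -/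
def F (f : DefiningFunction n) : Ambient n → Ambient n := gradient f.toFun

/-- The vector field `E_f = f F - 𝐅² D`, where `𝐅² = η(F, F)`. -/
def E (f : DefiningFunction n) (y : Ambient n) : Ambient n :=
  f.toFun y • f.F y - eta (f.F y) (f.F y) • dilation y

end DefiningFunction

/-- Alternating `a`-linear forms on `ℝ^{n+2}`. -/
abbrev Alt (n a : ℕ) : Type := (Ambient n) [⋀^Fin a]→L[ℝ] ℝ

/-- The interior product `i_u θ` (zero when `θ` has degree `0`). -/
def interior : {a : ℕ} → Ambient n → Alt n a → Alt n (a - 1)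
  | 0, _, _ => 0
  | _ + 1, u, θ => θ.curryLeft u

/-- The Lie derivative `(𝓛_V θ)_x (v₁, …, v_a)
  = (V · θ)_x (v₁, …, v_a) + ∑ᵢ θ_x (v₁, …, DV_x vᵢ, …, v_a)`
of a differential form on `ℝ^{n+2}` along a vector field. -/
def lieDeriv {a : ℕ} (V : Ambient n → Ambient n) (θ : Ambient n → Alt n a)
    (x : Ambient n) (v : Fin a → Ambient n) : ℝ :=
  fderiv ℝ θ x (V x) v + ∑ i, θ x (Function.update v i (fderiv ℝ V x (v i)))

/-- Smooth differential `a`-forms on a subset `U` of `ℝ^{n+2}` (used for open `U`). A form is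
extended by zero outside `U`, so that two forms are equal exactly when they agree on `U`. -/
structure AmbientForm (n : ℕ) (U : Set (Ambient n)) (a : ℕ) where
  toFun : Ambient n → Alt n a
  smooth : ContDiffOn ℝ ∞ toFun U
  eq_zero_off : ∀ x, x ∉ U → toFun x = 0

lemma contDiff_cone : ContDiff ℝ ∞ (cone (n := n)) := by
  unfold cone eta
  fun_prop

/-- The velocities of a smooth map with values in `X_f` are tangent to `X_f`. -/
lemma fderiv_mem_tangent {f : DefiningFunction n} {k : ℕ} {V : Set (Fin k → ℝ)}
    {φ : (Fin k → ℝ) → Ambient n} (hV : IsOpen V) (hφ : ContDiffOn ℝ ∞ φ V)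
    (hX : MapsTo φ V f.X) {u : Fin k → ℝ} (hu : u ∈ V) (w : Fin k → ℝ) :
    fderiv ℝ φ u w ∈ f.tangent (φ u) := by
  have hVn : V ∈ 𝓝 u := hV.mem_nhds hu
  have hd : DifferentiableAt ℝ φ u := (hφ.contDiffAt hVn).differentiableAt (by simp)
  have key : ∀ g : Ambient n → ℝ, ∀ k : ℝ, DifferentiableAt ℝ g (φ u) →
      (∀ y ∈ f.X, g y = k) → fderiv ℝ g (φ u) (fderiv ℝ φ u w) = 0 := by
    intro g k hg hk
    have h1 : fderiv ℝ (g ∘ φ) u = (fderiv ℝ g (φ u)).comp (fderiv ℝ φ u) :=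
      fderiv_comp u hg hd
    have h2 : (g ∘ φ) =ᶠ[𝓝 u] fun _ => k :=
      Filter.eventuallyEq_of_mem hVn fun z hz => hk _ (hX hz)
    rw [h2.fderiv_eq] at h1
    simpa using (DFunLike.congr_fun h1 w).symm
  refine ⟨?_, ?_⟩
  · exact key _ 0 (contDiff_cone.differentiable (by simp) _) fun y hy => hy.2.1
  · exact key _ 1 ((f.smooth.contDiffAt
      (f.isOpen_domain.mem_nhds (hX hu).1)).differentiableAt (by simp)) fun y hy => hy.2.2

/-- Smooth differential `a`-forms on the open part `X_f ∩ U` of the `n`-dimensional submanifold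
`X_f`: families of alternating forms on the tangent spaces whose pull-back under every smooth map
from an open subset of `ℝⁿ` to `X_f ∩ U` has smooth components. -/
structure SpacetimeForm (f : DefiningFunction n) (U : Set (Ambient n)) (a : ℕ) where
  toFun : ∀ y : ↥(f.X ∩ U), (f.tangent (y : Ambient n)) [⋀^Fin a]→L[ℝ] ℝ
  smooth : ∀ (V : Set (Fin n → ℝ)) (φ : (Fin n → ℝ) → Ambient n) (hV : IsOpen V)
    (hφ : ContDiffOn ℝ ∞ φ V) (hX : MapsTo φ V (f.X ∩ U)) (w : Fin a → Fin n → ℝ),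
    ∃ g : (Fin n → ℝ) → ℝ, ContDiffOn ℝ ∞ g V ∧ ∀ (u : Fin n → ℝ) (hu : u ∈ V),
      g u = toFun ⟨φ u, hX hu⟩ fun i =>
        ⟨fderiv ℝ φ u (w i), fderiv_mem_tangent hV hφ (fun _ hz => (hX hz).1) hu (w i)⟩

lemma contDiffOn_apply {a k : ℕ} {V : Set (Fin k → ℝ)} {m : (Fin k → ℝ) → Alt n a}
    {v : (Fin k → ℝ) → Fin a → Ambient n} (hm : ContDiffOn ℝ ∞ m V)
    (hv : ∀ i, ContDiffOn ℝ ∞ (fun u => v u i) V) :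
    ContDiffOn ℝ ∞ (fun u => m u (v u)) V := by
  have h : ∀ u, m u (v u) = ∑ s : Fin a → Fin (n + 2),
      (∏ i, v u i (s i)) * m u fun i => Pi.single (s i) 1 := by
    intro u
    have h1 : v u = fun i => ∑ j : Fin (n + 2), v u i j • (Pi.single j (1 : ℝ) : Ambient n) := by
      funext i
      exact pi_eq_sum_univ' (v u i)
    conv_lhs => rw [h1]
    have h2 := (m u).toMultilinearMap.map_sum
      (fun i j => v u i j • (Pi.single j (1 : ℝ) : Ambient n))
    refine h2.trans (Finset.sum_congr rfl fun s _ => ?_)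
    exact (m u).toMultilinearMap.map_smul_univ _ _
  simp_rw [h]
  refine ContDiffOn.sum fun s _ => ContDiffOn.mul (contDiffOn_prod fun i _ => ?_) ?_
  · exact contDiffOn_pi.1 (hv i) (s i)
  · exact (ContinuousAlternatingMap.apply ℝ (Ambient n) ℝ
      (fun i => (Pi.single (s i) 1 : Ambient n))).contDiff.comp_contDiffOn hm

/-- The pull-back `m_f^* θ` to `X_f ∩ U` under the canonical injection `m_f`: restriction to points
of `X_f` and to vectors tangent to `X_f`. -/
def pullback (f : DefiningFunction n) {U : Set (Ambient n)} {a : ℕ} (θ : AmbientForm n U a) :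
    SpacetimeForm f U a where
  toFun y := (θ.toFun y).compContinuousLinearMap (f.tangent (y : Ambient n)).subtypeL
  smooth V φ hV hφ hX w := by
    refine ⟨fun u => θ.toFun (φ u) fun i => fderiv ℝ φ u (w i), ?_, fun u hu => rfl⟩
    refine contDiffOn_apply (θ.smooth.comp hφ fun u hu => (hX hu).2) fun i => ?_
    exact (hφ.fderiv_of_isOpen hV (m := ∞) (by simp)).clm_apply contDiffOn_const

/-- `θ` restricts, on `X_f ∩ U` and on vectors tangent to `X_f`, to the form `β`. -/
def PullsBackTo {f : DefiningFunction n} {U : Set (Ambient n)} {a : ℕ}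
    (θ : Ambient n → Alt n a) (β : SpacetimeForm f U a) : Prop :=
  ∀ (y : ↥(f.X ∩ U)) (v : Fin a → f.tangent (y : Ambient n)),
    θ y (fun i => (v i : Ambient n)) = β.toFun y v

/-- `θ` is transverse on `S`: `i_D θ = i_F θ = 0` at the points of `S`. -/
def IsTransverseOn (f : DefiningFunction n) (S : Set (Ambient n)) {a : ℕ}
    (θ : Ambient n → Alt n a) : Prop :=
  ∀ x ∈ S, interior (dilation x) (θ x) = 0 ∧ interior (f.F x) (θ x) = 0

/-- `θ` extends `β`: at each point of `X_f ∩ U`, `θ` is equal to `β`, where a form on `T_y X_f` is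
identified with the form on `ℝ^{n+2} = T_y X_f ⊕ span(F, D)` that restricts to it and that vanishes
as soon as one argument is `D` or `F`. -/
def Extends {f : DefiningFunction n} {U : Set (Ambient n)} {a : ℕ}
    (θ : Ambient n → Alt n a) (β : SpacetimeForm f U a) : Prop :=
  PullsBackTo θ β ∧ IsTransverseOn f (f.X ∩ U) θ

/-- `𝓛_D θ = r θ` on `U`. -/
def IsHomogeneousOn (U : Set (Ambient n)) (r : ℝ) {a : ℕ} (θ : Ambient n → Alt n a) : Prop :=
  ∀ x ∈ U, ∀ v, lieDeriv dilation θ x v = r * θ x v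

/-- `𝓛_V θ = 0` on `U`. -/
def IsInvariantOn (V : Ambient n → Ambient n) (U : Set (Ambient n)) {a : ℕ}
    (θ : Ambient n → Alt n a) : Prop :=
  ∀ x ∈ U, ∀ v, lieDeriv V θ x v = 0

/-- The forms `θ` on `U` with `i_D θ = i_F θ = 0`, `𝓛_D θ = r θ` and `𝓛_V θ = 0`; for `V = F`,
these are the strongly transverse forms of degree `r` on `U`. -/
def IsStronglyTransverseOn (f : DefiningFunction n) (V : Ambient n → Ambient n)
    (U : Set (Ambient n)) (r : ℝ) {a : ℕ} (θ : Ambient n → Alt n a) : Prop :=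
  IsTransverseOn f U θ ∧ IsHomogeneousOn U r θ ∧ IsInvariantOn V U θ

end NullConeForms

end

/-! Both choices of `V` are homogeneous (degree 1 for `E_f`, 0 for `F`) and satisfy `dc(V) = 1` on
`X_f`, while there `dc(D) = 0` and `df(D) = 1`. Hence `D` and `V` span a complement of `T X_f`. Let
`σ` parametrise `X_f` locally and let `φ` be the flow of `V`. Then `Ψ(l, t, u) = l • φ(t, σ u)` is a
local diffeomorphism, and homogeneity of degree `d` gives `D = l ∂_l` and `V = l^(d-1) ∂_t` in the
coordinates `(l, t, u)`. On a small box, `X_f` is the slice `l = 1`, `t = 0` (`exists_flowBox`).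

Existence: the form `l^r u^*(σ^* β)` is an extension. The map `u` is constant along `D` and `V`, so
pull-backs by `u` are invariant under both fields and annihilated by them; the factor `l^r` supplies
the degree `r` and is constant along `V` (`lieDeriv_rpow_smul_pullback`). Where `f ≠ 0`, the field
`F` is a combination of `D` and `V`, which gives transversality on the whole box.

Uniqueness: two extensions coincide on `X_f`, where tangent vectors, `D` and `F` span everything
(`Extends.eqOn`). Along an integral curve of `D` or `V` the Lie derivative equation is a linear ODE
for their difference, so Grönwall propagates its vanishing (`JoinedAlong.eq_zero`), first along `D`,
then along `V`.

The extension near all of `X_f` is glued from local ones, which agree by uniqueness on boxes. Smooth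
dependence of flows on time and initial point comes from the inverse function theorem applied to the
Picard equation in a space of curves. -/

noncomputable section

namespace NullConeForms

/-! ### Smooth local flows of vector fields -/

section SmoothFlow

universe v

/-- The inverse function theorem for `C^∞` maps, with an inverse that is `C^∞` on its whole
domain. -/
theorem exists_openPartialHomeomorph_contDiffOn {E F : Type*} [NormedAddCommGroup E]
    [NormedSpace ℝ E] [CompleteSpace E] [NormedAddCommGroup F] [NormedSpace ℝ F]
    {g : E → F} {S : Set E} {a : E} (hS : IsOpen S) (ha : a ∈ S) (hg : ContDiffOn ℝ ∞ g S)
    (g' : E ≃L[ℝ] F) (hg' : HasFDerivAt g (g' : E →L[ℝ] F) a) :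
    ∃ e : OpenPartialHomeomorph E F, a ∈ e.source ∧ e.source ⊆ S ∧ (∀ x, e x = g x) ∧
      ContDiffOn ℝ ∞ e.symm e.target := by
  have hga : ContDiffAt ℝ ∞ g a := hg.contDiffAt (hS.mem_nhds ha)
  have hcont : ContinuousOn (fderiv ℝ g) S := hg.continuousOn_fderiv_of_isOpen hS (by simp)
  -- Invertibility of the derivative is an open condition; imposing it on the source makes the
  -- inverse smooth at every point of the target, not only at `g a`.
  set T : Set E := S ∩ fderiv ℝ g ⁻¹' range ((↑) : (E ≃L[ℝ] F) → E →L[ℝ] F) with hT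
  have hTo : IsOpen T := hcont.isOpen_inter_preimage hS ContinuousLinearEquiv.isOpen
  have haT : a ∈ T := ⟨ha, g', hg'.fderiv.symm⟩
  refine ⟨(hga.toOpenPartialHomeomorph g hg' (by simp)).restrOpen T hTo,
    ⟨hga.mem_toOpenPartialHomeomorph_source hg' (by simp), haT⟩, fun x hx => hx.2.1,
    fun x => rfl, ?_⟩
  intro y hy
  set e := (hga.toOpenPartialHomeomorph g hg' (by simp)).restrOpen T hTo with he
  have hx : e.symm y ∈ T := (e.map_target hy).2
  obtain ⟨L, hL⟩ := hx.2
  have hgx : ContDiffAt ℝ ∞ g (e.symm y) := hg.contDiffAt (hS.mem_nhds hx.1)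
  refine (e.contDiffAt_symm (f₀' := L) hy ?_ hgx).contDiffWithinAt
  rw [hL]
  exact (hgx.differentiableAt (by simp)).hasFDerivAt

variable {K : Type*} [TopologicalSpace K] [CompactSpace K]
variable {E F : Type v} [NormedAddCommGroup E] [NormedSpace ℝ E]
  [NormedAddCommGroup F] [NormedSpace ℝ F]

/-- Pointwise application of continuous families of operators to continuous families of
vectors. -/
def pointwiseApply : C(K, E →L[ℝ] F) →L[ℝ] C(K, E) →L[ℝ] C(K, F) :=
  LinearMap.mkContinuous₂
    (LinearMap.mk₂ ℝ (fun (A : C(K, E →L[ℝ] F)) (y : C(K, E)) =>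
        (⟨fun t => A t (y t), by fun_prop⟩ : C(K, F)))
      (fun _ _ _ => by ext; simp) (fun _ _ _ => by ext; simp)
      (fun _ _ _ => by ext; simp) (fun _ _ _ => by ext; simp)) 1 (by
    intro A y
    rw [one_mul, ContinuousMap.norm_le _ (by positivity)]
    intro t
    exact ((A t).le_opNorm (y t)).trans
      (mul_le_mul (A.norm_coe_le_norm t) (y.norm_coe_le_norm t) (norm_nonneg _) (by positivity)))

@[simp]
lemma pointwiseApply_apply (A : C(K, E →L[ℝ] F)) (y : C(K, E)) (t : K) :
    pointwiseApply A y t = A t (y t) := rfl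

/-- Compact support makes the derivative of `V` uniformly continuous, so the mean value estimate at
each `t` holds with one `δ` and becomes an estimate in the sup norm. -/
lemma hasFDerivAt_comp_continuousMap {V : E → F} (hV : ContDiff ℝ ∞ V)
    (hs : HasCompactSupport V) (hV' : Continuous (fderiv ℝ V)) (y : C(K, E)) :
    HasFDerivAt (fun y : C(K, E) => (⟨V, hV.continuous⟩ : C(E, F)).comp y)
      (pointwiseApply ((⟨fderiv ℝ V, hV'⟩ : C(E, E →L[ℝ] F)).comp y)) y := by
  rw [hasFDerivAt_iff_isLittleO_nhds_zero, Asymptotics.isLittleO_iff]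
  intro c hc
  have huc := (hs.fderiv (𝕜 := ℝ)).uniformContinuous_of_continuous hV'
  obtain ⟨δ, hδ, h⟩ := Metric.uniformContinuous_iff.1 huc c hc
  filter_upwards [Metric.ball_mem_nhds (0 : C(K, E)) hδ] with w hw
  rw [ContinuousMap.norm_le _ (by positivity)]
  intro t
  have hwt : ‖w t‖ < δ := (w.norm_coe_le_norm t).trans_lt (by simpa using hw)
  have key := (convex_ball (y t) δ).norm_image_sub_le_of_norm_fderiv_le' (𝕜 := ℝ) (f := V)
    (φ := fderiv ℝ V (y t)) (C := c) (x := y t) (y := y t + w t)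
    (fun x _ => hV.differentiable (by simp) x)
    (fun x hx => by
      rw [← dist_eq_norm]
      exact (h hx).le) (Metric.mem_ball_self hδ) (by simpa using hwt)
  refine le_trans ?_ (key.trans ?_)
  · simp
  · rw [add_sub_cancel_left]
    exact mul_le_mul_of_nonneg_left (w.norm_coe_le_norm t) hc.le

/-- Composition with a compactly supported smooth map is a smooth operator on spaces of continuous
maps. -/
theorem contDiff_comp_continuousMap {V : E → F} (hV : ContDiff ℝ ∞ V)
    (hs : HasCompactSupport V) :
    ContDiff ℝ ∞ (fun y : C(K, E) => (⟨V, hV.continuous⟩ : C(E, F)).comp y) := by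
  rw [contDiff_infty]
  intro k
  -- The target varies because the derivative is again governed by a composition operator, that of
  -- `fderiv ℝ V`, with values in `E →L[ℝ] F`.
  induction k generalizing F with
  | zero => exact contDiff_zero.2 (ContinuousMap.continuous_postcomp _)
  | succ k ih =>
    have hd : ContDiff ℝ ∞ (fderiv ℝ V) := hV.fderiv_right (by simp)
    rw [Nat.cast_succ, contDiff_succ_iff_hasFDerivAt]
    have hA : ContDiff ℝ k fun y : C(K, E) =>
        (⟨fderiv ℝ V, hd.continuous⟩ : C(E, E →L[ℝ] F)).comp y := ih hd (hs.fderiv (𝕜 := ℝ))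
    exact ⟨fun y => pointwiseApply ((⟨fderiv ℝ V, hd.continuous⟩ : C(E, E →L[ℝ] F)).comp y),
      by fun_prop,
      fun y => hasFDerivAt_comp_continuousMap hV hs hd.continuous y⟩

/-- The symmetric interval on which curves are parametrised. -/
abbrev SymmIcc : Type := Icc (-1 : ℝ) 1

/-- The continuous extension of a curve by constants. -/
def extendCurve (y : C(SymmIcc, E)) (s : ℝ) : E := y (projIcc (-1) 1 (by norm_num) s)

omit [NormedSpace ℝ E] in
lemma continuous_extendCurve (y : C(SymmIcc, E)) : Continuous (extendCurve y) :=
  y.continuous.comp continuous_projIcc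

omit [NormedSpace ℝ E] in
lemma extendCurve_of_mem (y : C(SymmIcc, E)) {s : ℝ} (hs : s ∈ Icc (-1 : ℝ) 1) :
    extendCurve y s = y ⟨s, hs⟩ := by
  rw [extendCurve, projIcc_of_mem _ hs]

omit [NormedSpace ℝ E] in
lemma norm_extendCurve_le (y : C(SymmIcc, E)) (s : ℝ) : ‖extendCurve y s‖ ≤ ‖y‖ :=
  y.norm_coe_le_norm _

/-- The primitive, vanishing at `0`, of a curve. -/
def primitiveCLM : C(SymmIcc, E) →L[ℝ] C(SymmIcc, E) :=
  LinearMap.mkContinuous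
    { toFun := fun y => ⟨fun t => ∫ s in (0 : ℝ)..t, extendCurve y s,
        (intervalIntegral.continuous_primitive
          (fun a b => (continuous_extendCurve y).intervalIntegrable a b) 0).comp
            continuous_subtype_val⟩
      map_add' := fun y z => by
        ext t
        exact intervalIntegral.integral_add ((continuous_extendCurve y).intervalIntegrable _ _)
          ((continuous_extendCurve z).intervalIntegrable _ _)
      map_smul' := fun c y => by
        ext t
        exact intervalIntegral.integral_smul c (extendCurve y) } 1 (by
    intro y
    rw [one_mul, ContinuousMap.norm_le _ (norm_nonneg _)]
    intro t
    refine (intervalIntegral.norm_integral_le_of_norm_le_const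
      (fun s _ => norm_extendCurve_le y s)).trans ?_
    have : |(t : ℝ) - 0| ≤ 1 := by
      rw [sub_zero]
      exact abs_le.2 t.2
    exact mul_le_of_le_one_right (norm_nonneg _) this)

variable [CompleteSpace E]

/-- A fixed point of the Picard operator is an integral curve. -/
lemma hasDerivAt_of_fixed {V : E → E} (hV : Continuous V) {τ : ℝ} {x : E} {y : C(SymmIcc, E)}
    (hy : y = ContinuousMap.const _ x + τ • primitiveCLM ((⟨V, hV⟩ : C(E, E)).comp y)) :
    ∃ γ : ℝ → E, γ 0 = x ∧ (∀ t : SymmIcc, γ t = y t) ∧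
      ∀ t ∈ Icc (-1 : ℝ) 1, HasDerivAt γ (τ • V (γ t)) t := by
  set z : C(SymmIcc, E) := (⟨V, hV⟩ : C(E, E)).comp y with hz
  have hyt : ∀ t : SymmIcc, x + τ • ∫ s in (0 : ℝ)..t, extendCurve z s = y t := by
    intro t
    conv_rhs => rw [hy]
    rfl
  -- The integral formula makes sense on all of `ℝ`, whence two-sided derivatives even at the
  -- endpoints `±1`.
  refine ⟨fun t => x + τ • ∫ s in (0 : ℝ)..t, extendCurve z s, by simp, hyt, ?_⟩
  intro t ht
  have h1 := ((continuous_extendCurve z).integral_hasStrictDerivAt 0 t).hasDerivAt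
  have h2 := (h1.const_smul τ).const_add x
  have h3 : extendCurve z t = V (x + τ • ∫ s in (0 : ℝ)..t, extendCurve z s) := by
    rw [hyt ⟨t, ht⟩, extendCurve_of_mem z ht]
    rfl
  rw [h3] at h2
  exact h2

/-- Solutions of rescaled equations are rescalings of each other. -/
lemma fixed_rescale {V : E → E} (hV : Continuous V) {k : NNReal} (hk : LipschitzWith k V)
    {τ σ : ℝ} (hσ : σ ∈ Icc (-1 : ℝ) 1) {x : E} {y w : C(SymmIcc, E)}
    (hy : y = ContinuousMap.const _ x + τ • primitiveCLM ((⟨V, hV⟩ : C(E, E)).comp y))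
    (hw : w = ContinuousMap.const _ x + (σ * τ) • primitiveCLM ((⟨V, hV⟩ : C(E, E)).comp w)) :
    w ⟨1, by norm_num⟩ = y ⟨σ, hσ⟩ := by
  obtain ⟨γ, hγ0, hγy, hγ⟩ := hasDerivAt_of_fixed hV hy
  obtain ⟨ρ, hρ0, hρw, hρ⟩ := hasDerivAt_of_fixed hV hw
  have hmem : ∀ s ∈ Icc (0 : ℝ) 1, σ * s ∈ Icc (-1 : ℝ) 1 := by
    intro s hs
    have h1 : |σ * s| ≤ 1 := by
      rw [abs_mul]
      exact mul_le_one₀ (abs_le.2 hσ) (abs_nonneg _) (abs_le.2 ⟨by linarith [hs.1], hs.2⟩)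
    exact abs_le.1 h1
  have hγ' : ∀ s ∈ Icc (0 : ℝ) 1,
      HasDerivAt (fun s => γ (σ * s)) ((σ * τ) • V (γ (σ * s))) s := by
    intro s hs
    have h1 : HasDerivAt (fun s : ℝ => σ * s) σ s := by
      simpa using (hasDerivAt_id s).const_mul σ
    have h2 := (hγ (σ * s) (hmem s hs)).scomp s h1
    rw [smul_smul] at h2
    exact h2
  have hρ' : ∀ s ∈ Icc (0 : ℝ) 1, HasDerivAt ρ ((σ * τ) • V (ρ s)) s :=
    fun s hs => hρ s ⟨by linarith [hs.1], hs.2⟩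
  have hlip : ∀ _ : ℝ, LipschitzWith (‖σ * τ‖₊ * k) (fun z => (σ * τ) • V z) :=
    fun _ => (lipschitzWith_smul (σ * τ)).comp hk
  -- Both `ρ` and `s ↦ γ (σ * s)` solve the equation with speed `σ * τ` and start at `x`. Working on
  -- `[0, 1]` covers negative `σ` too.
  have h := ODE_solution_unique (f := ρ) (g := fun s => γ (σ * s)) (a := 0) (b := 1) hlip
    (fun s hs => (hρ' s hs).continuousAt.continuousWithinAt)
    (fun s hs => (hρ' s (Ico_subset_Icc_self hs)).hasDerivWithinAt)
    (fun s hs => (hγ' s hs).continuousAt.continuousWithinAt)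
    (fun s hs => (hγ' s (Ico_subset_Icc_self hs)).hasDerivWithinAt)
    (by simp [hγ0, hρ0])
  have h1 := h (right_mem_Icc.2 zero_le_one)
  have h2 := hρw ⟨1, by norm_num⟩
  have h3 := hγy ⟨σ, hσ⟩
  simp only [mul_one] at h1
  rw [← h2, ← h3]
  exact h1

/-- The local flow of a compactly supported smooth vector field is smooth. -/
theorem exists_smooth_flow_of_hasCompactSupport {V : E → E} (hV : ContDiff ℝ ∞ V)
    (hs : HasCompactSupport V) (x₀ : E) :
    ∃ (S : Set (ℝ × E)) (φ : ℝ × E → E), IsOpen S ∧ (0, x₀) ∈ S ∧ ContDiffOn ℝ ∞ φ S ∧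
      (∀ x, (0, x) ∈ S → φ (0, x) = x) ∧
      ∀ t x, (t, x) ∈ S → HasDerivAt (fun s => φ (s, x)) (V (φ (t, x))) t := by
  obtain ⟨k, hk⟩ := ContDiff.lipschitzWith_of_hasCompactSupport hs hV (by simp)
  set N : C(SymmIcc, E) → C(SymmIcc, E) := fun y => (⟨V, hV.continuous⟩ : C(E, E)).comp y with hN
  have hNs : ContDiff ℝ ∞ N := contDiff_comp_continuousMap hV hs
  set const := ContinuousLinearMap.const ℝ (M := E) SymmIcc with hconst
  -- The second component of `G ((τ, x), y)` vanishes exactly when `y` is a Picard fixed point with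
  -- speed `τ`. At `τ = 0` the integral term contributes nothing to the derivative in `y`, so `G'`
  -- is triangular with identity diagonal.
  set G : (ℝ × E) × C(SymmIcc, E) → (ℝ × E) × C(SymmIcc, E) := fun q =>
    (q.1, q.2 + (-const q.1.2 - q.1.1 • primitiveCLM (N q.2))) with hG
  have hGs : ContDiff ℝ ∞ G := by fun_prop
  set q₀ : (ℝ × E) × C(SymmIcc, E) := ((0, x₀), const x₀) with hq₀
  set A : ℝ × E →L[ℝ] C(SymmIcc, E) :=
    -(const.comp (ContinuousLinearMap.snd ℝ ℝ E)) -
      (ContinuousLinearMap.fst ℝ ℝ E).smulRight (primitiveCLM (N (const x₀))) with hA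
  set G' := (ContinuousLinearEquiv.refl ℝ (ℝ × E)).skewProd
    (ContinuousLinearEquiv.refl ℝ C(SymmIcc, E)) A with hG'
  have hGd : HasFDerivAt G (G' : (ℝ × E) × C(SymmIcc, E) →L[ℝ] (ℝ × E) × C(SymmIcc, E)) q₀ := by
    have h1 : HasFDerivAt (fun q : (ℝ × E) × C(SymmIcc, E) => q.1)
      (ContinuousLinearMap.fst ℝ _ _) q₀ := hasFDerivAt_fst
    have h2 : HasFDerivAt (fun q : (ℝ × E) × C(SymmIcc, E) => q.2)
      (ContinuousLinearMap.snd ℝ _ _) q₀ := hasFDerivAt_snd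
    have h3 : HasFDerivAt (fun q : (ℝ × E) × C(SymmIcc, E) => const q.1.2) _ q₀ :=
      const.hasFDerivAt.comp q₀ h1.snd
    have h4s : ContDiff ℝ ∞ (fun q : (ℝ × E) × C(SymmIcc, E) => primitiveCLM (N q.2)) := by
      fun_prop
    have h4 := (h4s.differentiable (by simp) q₀).hasFDerivAt
    have h5 := h1.prodMk (h2.add (h3.neg.sub (h1.fst.smul h4)))
    refine h5.congr_fderiv ?_
    ext q <;> simp [G', A, q₀, ContinuousLinearEquiv.skewProd_apply]
  obtain ⟨e, heq₀, -, he, hes⟩ := exists_openPartialHomeomorph_contDiffOn isOpen_univ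
    (mem_univ q₀) hGs.contDiffOn G' hGd
  have hGq₀ : G q₀ = ((0, x₀), 0) := by simp [hG, hq₀]
  have ht₀ : (((0, x₀), 0) : (ℝ × E) × C(SymmIcc, E)) ∈ e.target := by
    rw [← hGq₀, ← he]
    exact e.map_source heq₀
  set S₁ : Set (ℝ × E) := (fun p => (p, (0 : C(SymmIcc, E)))) ⁻¹' e.target with hS₁
  have hS₁o : IsOpen S₁ := e.open_target.preimage (by fun_prop)
  set Y : ℝ × E → C(SymmIcc, E) := fun p => (e.symm (p, 0)).2 with hY
  have hYs : ContDiffOn ℝ ∞ Y S₁ :=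
    contDiff_snd.comp_contDiffOn (hes.comp (by fun_prop) fun p hp => hp)
  have hYfix : ∀ p ∈ S₁, Y p = ContinuousMap.const _ p.2 +
      p.1 • primitiveCLM ((⟨V, hV.continuous⟩ : C(E, E)).comp (Y p)) := by
    intro p hp
    have h1 : G (e.symm (p, 0)) = (p, 0) := by rw [← he]; exact e.right_inv hp
    have h2 : (e.symm (p, 0)).1 = p := congrArg Prod.fst h1
    have h3 : Y p + (-const (e.symm (p, 0)).1.2 -
        (e.symm (p, 0)).1.1 • primitiveCLM (N (Y p))) = 0 := congrArg Prod.snd h1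
    rw [h2] at h3
    have h4 : Y p = const p.2 + p.1 • primitiveCLM (N (Y p)) := by
      rw [← sub_eq_zero, ← h3]
      abel
    exact h4
  obtain ⟨ρ, hρ, hball⟩ := Metric.isOpen_iff.1 hS₁o (0, x₀) ht₀
  -- Half the radius, so that the time `ε` itself is still admissible for every nearby initial
  -- point.
  set ε := ρ / 2 with hε
  have hε0 : 0 < ε := half_pos hρ
  have hmem : ∀ p ∈ Metric.ball ((0 : ℝ), x₀) ε, p ∈ S₁ ∧ (ε, p.2) ∈ S₁ ∧ |p.1| < ε := by
    rintro ⟨t, x⟩ hp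
    rw [Metric.mem_ball, Prod.dist_eq, max_lt_iff, Real.dist_0_eq_abs] at hp
    refine ⟨hball ?_, hball ?_, hp.1⟩
    · rw [Metric.mem_ball, Prod.dist_eq, max_lt_iff, Real.dist_0_eq_abs]
      exact ⟨hp.1.trans (half_lt_self hρ), hp.2.trans (half_lt_self hρ)⟩
    · rw [Metric.mem_ball, Prod.dist_eq, max_lt_iff, Real.dist_0_eq_abs, abs_of_pos hε0]
      exact ⟨half_lt_self hρ, hp.2.trans (half_lt_self hρ)⟩
  have hσ : ∀ t, |t| < ε → t / ε ∈ Icc (-1 : ℝ) 1 := by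
    intro t ht
    refine abs_le.1 ?_
    rw [abs_div, abs_of_pos hε0]
    exact (div_le_one hε0).2 ht.le
  -- The flow at time `t` is the value at parameter 1 of the curve run at speed `t`. This is visibly
  -- smooth in `(t, x)`; for the derivative in `t`, the curves with `|t| < ε` are all viewed as
  -- rescalings of the single curve with speed `ε`.
  set φ : ℝ × E → E := fun p => Y p ⟨1, by norm_num⟩ with hφ
  have hφY : ∀ p (hp : p ∈ Metric.ball ((0 : ℝ), x₀) ε),
      φ p = Y (ε, p.2) ⟨p.1 / ε, hσ _ (hmem p hp).2.2⟩ := by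
    intro p hp
    refine fixed_rescale hV.continuous hk _ (hYfix _ (hmem p hp).2.1) ?_
    rw [div_mul_cancel₀ _ hε0.ne']
    exact hYfix _ (hmem p hp).1
  refine ⟨Metric.ball (0, x₀) ε, φ, Metric.isOpen_ball, Metric.mem_ball_self hε0, ?_, ?_, ?_⟩
  · exact (ContinuousMap.evalCLM ℝ (M := E) (⟨1, by norm_num⟩ : SymmIcc)).contDiff.comp_contDiffOn
      (hYs.mono fun p hp => (hmem p hp).1)
  · intro x hx
    rw [hφ]
    dsimp only
    rw [hYfix _ (hmem _ hx).1]
    simp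
  · intro t x hp
    obtain ⟨γ, hγ0, hγy, hγ⟩ := hasDerivAt_of_fixed hV.continuous (hYfix _ (hmem _ hp).2.1)
    have hφγ : ∀ s, (s, x) ∈ Metric.ball ((0 : ℝ), x₀) ε → φ (s, x) = γ (s / ε) := by
      intro s hs
      rw [hφY _ hs]
      exact (hγy ⟨s / ε, _⟩).symm
    have h1 : HasDerivAt (fun s : ℝ => s / ε) (1 / ε) t := (hasDerivAt_id t).div_const ε
    have h2 := (hγ (t / ε) (hσ t (hmem _ hp).2.2)).scomp t h1
    rw [smul_smul, one_div_mul_cancel hε0.ne', one_smul, ← hφγ t hp] at h2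
    refine h2.congr_of_eventuallyEq ?_
    have : (fun s : ℝ => (s, x)) ⁻¹' Metric.ball ((0 : ℝ), x₀) ε ∈ 𝓝 t :=
      (Metric.isOpen_ball.preimage (by fun_prop)).mem_nhds hp
    filter_upwards [this] with s hs using hφγ s hs

/-- Smooth vector fields on open subsets of finite-dimensional spaces have smooth local flows. -/
theorem exists_smooth_local_flow [FiniteDimensional ℝ E] {V : E → E} {Ω : Set E}
    (hΩ : IsOpen Ω) (hV : ContDiffOn ℝ ∞ V Ω) {x₀ : E} (hx₀ : x₀ ∈ Ω) :
    ∃ (S : Set (ℝ × E)) (φ : ℝ × E → E), IsOpen S ∧ (0, x₀) ∈ S ∧ ContDiffOn ℝ ∞ φ S ∧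
      MapsTo φ S Ω ∧ (∀ x, (0, x) ∈ S → φ (0, x) = x) ∧
      ∀ t x, (t, x) ∈ S → HasDerivAt (fun s => φ (s, x)) (V (φ (t, x))) t := by
  obtain ⟨ρ, hρ, hball⟩ := Metric.isOpen_iff.1 hΩ x₀ hx₀
  let χ : ContDiffBump x₀ := ⟨ρ / 3, ρ / 2, by positivity, by linarith⟩
  have hsupp : tsupport χ ⊆ Ω := by
    rw [χ.tsupport_eq]
    exact (Metric.closedBall_subset_ball (half_lt_self hρ)).trans hball
  have hW : ContDiff ℝ ∞ fun x => χ x • V x := by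
    rw [contDiff_iff_contDiffAt]
    intro x
    by_cases hx : x ∈ tsupport χ
    · exact χ.contDiff.contDiffAt.smul (hV.contDiffAt (hΩ.mem_nhds (hsupp hx)))
    · have h1 : (fun x => χ x • V x) =ᶠ[𝓝 x] fun _ => 0 := by
        filter_upwards [(isClosed_tsupport χ).isOpen_compl.mem_nhds hx] with z hz
        rw [image_eq_zero_of_notMem_tsupport hz, zero_smul]
      exact contDiffAt_const.congr_of_eventuallyEq h1
  obtain ⟨S, φ, hSo, hS, hφ, hφ0, hφd⟩ :=
    exists_smooth_flow_of_hasCompactSupport hW χ.hasCompactSupport.smul_right x₀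
  have hφ0' : φ (0, x₀) = x₀ := hφ0 _ hS
  -- On this ball the cut-off is 1, so the flow of `χ • V` is a flow of `V` as long as it stays
  -- there.
  refine ⟨S ∩ φ ⁻¹' Metric.ball x₀ (ρ / 3), φ,
    hφ.continuousOn.isOpen_inter_preimage hSo Metric.isOpen_ball, ⟨hS, ?_⟩,
    hφ.mono inter_subset_left, ?_, fun x hx => hφ0 x hx.1, ?_⟩
  · rw [mem_preimage, hφ0']
    exact Metric.mem_ball_self (by positivity)
  · intro p hp
    exact hball (Metric.ball_subset_ball (by linarith) hp.2)
  · intro t x hp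
    have h1 := hφd t x hp.1
    rwa [χ.one_of_mem_closedBall (Metric.ball_subset_closedBall hp.2), one_smul] at h1

end SmoothFlow

end NullConeForms

/-! ### Homogeneity identities and the geometry of `X_f` -/

namespace NullConeForms

variable {n : ℕ}

lemma etaSign_mul_self (α : Fin (n + 2)) : etaSign n α * etaSign n α = 1 := by
  unfold etaSign
  split_ifs <;> norm_num

lemma eta_comm (u v : Ambient n) : eta u v = eta v u :=
  Finset.sum_congr rfl fun α _ => by ring

lemma eta_smul_right (t : ℝ) (u v : Ambient n) : eta u (t • v) = t * eta u v := by
  simp only [eta, Pi.smul_apply, smul_eq_mul, Finset.mul_sum]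
  exact Finset.sum_congr rfl fun α _ => by ring

lemma eta_smul_left (t : ℝ) (u v : Ambient n) : eta (t • u) v = t * eta u v := by
  rw [eta_comm, eta_smul_right, eta_comm]

lemma cone_smul (t : ℝ) (y : Ambient n) : cone (t • y) = t ^ 2 * cone y := by
  rw [cone, cone, eta_smul_left, eta_smul_right]
  ring

/-- The differential of `c` at `y` is `η(y, ·)`. -/
lemma fderiv_cone (y v : Ambient n) : fderiv ℝ (cone (n := n)) y v = eta y v := by
  have h : HasFDerivAt (cone (n := n)) ((1 / 2 : ℝ) • ∑ α : Fin (n + 2),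
      ((etaSign n α * y α) • ContinuousLinearMap.proj (R := ℝ) (φ := fun _ => ℝ) α +
        (y α) • (etaSign n α • ContinuousLinearMap.proj (R := ℝ) (φ := fun _ => ℝ) α))) y := by
    unfold cone eta
    refine HasFDerivAt.const_mul ?_ (1 / 2)
    refine HasFDerivAt.fun_sum fun α _ => ?_
    exact ((hasFDerivAt_apply α y).const_mul (etaSign n α)).mul (hasFDerivAt_apply α y)
  rw [h.fderiv]
  simp only [eta, smul_apply, sum_apply, add_apply, ContinuousLinearMap.proj_apply, smul_eq_mul,
    Finset.mul_sum]
  exact Finset.sum_congr rfl fun α _ => by ring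

/-- The gradient represents the differential with respect to `η`. -/
lemma eta_gradient (g : Ambient n → ℝ) (y v : Ambient n) :
    eta (gradient g y) v = fderiv ℝ g y v := by
  conv_rhs => rw [pi_eq_sum_univ' v, map_sum]
  simp only [eta, gradient, map_smul, smul_eq_mul]
  refine Finset.sum_congr rfl fun α _ => ?_
  rw [← mul_assoc, etaSign_mul_self]
  ring

namespace DefiningFunction

variable (f : DefiningFunction n)

lemma differentiableAt {y : Ambient n} (hy : y ∈ f.domain) : DifferentiableAt ℝ f.toFun y :=
  (f.smooth.contDiffAt (f.isOpen_domain.mem_nhds hy)).differentiableAt (by simp)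

/-- Euler's identity. -/
lemma fderiv_self {y : Ambient n} (hy : y ∈ f.domain) : fderiv ℝ f.toFun y y = f.toFun y := by
  have h1 : HasDerivAt (fun t : ℝ => f.toFun (t • y)) (fderiv ℝ f.toFun y y) 1 := by
    have h2 : HasDerivAt (fun t : ℝ => t • y) y 1 := by
      simpa using (hasDerivAt_id (1 : ℝ)).smul_const y
    have h3 : HasFDerivAt f.toFun (fderiv ℝ f.toFun y) ((1 : ℝ) • y) := by
      rw [one_smul]
      exact (f.differentiableAt hy).hasFDerivAt
    exact h3.comp_hasDerivAt (1 : ℝ) h2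
  have h4 : HasDerivAt (fun t : ℝ => f.toFun (t • y)) (f.toFun y) 1 := by
    have h5 : HasDerivAt (fun t : ℝ => t * f.toFun y) (f.toFun y) 1 := by
      simpa using (hasDerivAt_id (1 : ℝ)).mul_const (f.toFun y)
    refine h5.congr_of_eventuallyEq ?_
    filter_upwards [lt_mem_nhds (zero_lt_one (α := ℝ))] with t ht using f.homogeneous y hy t ht
  exact h1.unique h4

lemma fderiv_smul {y : Ambient n} (hy : y ∈ f.domain) {t : ℝ} (ht : 0 < t) :
    fderiv ℝ f.toFun (t • y) = fderiv ℝ f.toFun y := by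
  have h1 : HasFDerivAt (fun z => f.toFun (t • z))
      ((fderiv ℝ f.toFun (t • y)).comp (t • ContinuousLinearMap.id ℝ _)) y :=
    (f.differentiableAt (f.smul_mem y hy t ht)).hasFDerivAt.comp y
      ((hasFDerivAt_id y).const_smul t)
  have h2 : HasFDerivAt (fun z => f.toFun (t • z)) (t • fderiv ℝ f.toFun y) y := by
    refine ((f.differentiableAt hy).hasFDerivAt.const_smul t).congr_of_eventuallyEq ?_
    filter_upwards [f.isOpen_domain.mem_nhds hy] with z hz using f.homogeneous z hz t ht
  have h3 := h1.unique h2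
  ext v
  have h4 := DFunLike.congr_fun h3 v
  simp only [ContinuousLinearMap.comp_apply, smul_apply, map_smul,
    ContinuousLinearMap.id_apply, smul_eq_mul] at h4
  exact mul_left_cancel₀ ht.ne' h4

lemma F_smul {y : Ambient n} (hy : y ∈ f.domain) {t : ℝ} (ht : 0 < t) : f.F (t • y) = f.F y := by
  funext α
  rw [F, gradient, gradient, f.fderiv_smul hy ht]

lemma E_smul {y : Ambient n} (hy : y ∈ f.domain) {t : ℝ} (ht : 0 < t) :
    f.E (t • y) = t • f.E y := by
  rw [E, E, f.F_smul hy ht, f.homogeneous y hy t ht, dilation, dilation, smul_sub, smul_smul,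
    smul_smul, smul_smul, mul_comm t (eta _ _)]

lemma contDiffOn_F : ContDiffOn ℝ ∞ f.F f.domain := by
  refine contDiffOn_pi.2 fun α => ContDiffOn.mul contDiffOn_const ?_
  exact (f.smooth.fderiv_of_isOpen f.isOpen_domain (m := ∞) (by simp)).clm_apply contDiffOn_const

lemma contDiffOn_E : ContDiffOn ℝ ∞ f.E f.domain := by
  have h : ContDiffOn ℝ ∞ (fun y => eta (f.F y) (f.F y)) f.domain := by
    unfold eta
    refine ContDiffOn.sum fun α _ => ?_
    have hα := contDiffOn_pi.1 f.contDiffOn_F α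
    exact (contDiffOn_const.mul hα).mul hα
  exact (f.smooth.smul f.contDiffOn_F).sub (h.smul contDiffOn_id)

/-- A smooth homogeneous vector field which, together with the dilation field, spans a complement
of the tangent spaces of `X_f` that contains `F`. -/
structure IsTransversal (V : Ambient n → Ambient n) (d : ℕ) : Prop where
  smooth : ContDiffOn ℝ ∞ V f.domain
  homogeneous : ∀ y ∈ f.domain, ∀ t : ℝ, 0 < t → V (t • y) = t ^ d • V y
  fderiv_cone : ∀ y ∈ f.X, fderiv ℝ (cone (n := n)) y (V y) = 1
  F_mem_span : ∀ y ∈ f.domain, f.toFun y ≠ 0 → ∃ p q : ℝ, f.F y = p • y + q • V y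

/-- `dc_y = η(y, ·)` and `F` is the `η`-gradient of `f`, so `dc(F) = df(D)`, to which Euler's
identity applies. -/
lemma fderiv_cone_F {y : Ambient n} (hy : y ∈ f.domain) :
    fderiv ℝ (cone (n := n)) y (f.F y) = f.toFun y := by
  rw [NullConeForms.fderiv_cone, eta_comm, F, eta_gradient, f.fderiv_self hy]

lemma isTransversal_F : f.IsTransversal f.F 0 where
  smooth := f.contDiffOn_F
  homogeneous y hy t ht := by rw [f.F_smul hy ht, pow_zero, one_smul]
  fderiv_cone y hy := by rw [f.fderiv_cone_F hy.1, hy.2.2]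
  F_mem_span y _ _ := ⟨0, 1, by simp⟩

/-- On the cone `dc(D) = 2c = 0`, so the `D` term of `E_f` does not contribute and `dc(E_f) = f² =
1` on `X_f`. Dividing `E_f = f F - 𝐅² D` by `f` recovers `F`. -/
lemma isTransversal_E : f.IsTransversal f.E 1 where
  smooth := f.contDiffOn_E
  homogeneous y hy t ht := by rw [f.E_smul hy ht, pow_one]
  fderiv_cone y hy := by
    have h : eta y y = 0 := by
      have := hy.2.1
      rw [cone] at this
      linarith
    rw [E, map_sub, map_smul, map_smul, f.fderiv_cone_F hy.1, hy.2.2, NullConeForms.fderiv_cone,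
      dilation, h]
    simp
  F_mem_span y _ hf := by
    refine ⟨(f.toFun y)⁻¹ * eta (f.F y) (f.F y), (f.toFun y)⁻¹, ?_⟩
    rw [E, dilation, smul_sub, smul_smul, smul_smul, inv_mul_cancel₀ hf, one_smul]
    abel

lemma fderiv_cone_self {y : Ambient n} (hy : y ∈ f.X) : fderiv ℝ (cone (n := n)) y y = 0 := by
  have := hy.2.1
  rw [cone] at this
  rw [NullConeForms.fderiv_cone]
  linarith

lemma fderiv_self_of_mem {y : Ambient n} (hy : y ∈ f.X) : fderiv ℝ f.toFun y y = 1 := by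
  rw [f.fderiv_self hy.1, hy.2.2]

lemma mem_tangent {y v : Ambient n} : v ∈ f.tangent y ↔
    fderiv ℝ (cone (n := n)) y v = 0 ∧ fderiv ℝ f.toFun y v = 0 := Iff.rfl

/-- The differentials `dc` and `df` are independent on `X_f`: `D` has values `(0, 1)` and `F` has
first value 1. -/
lemma finrank_tangent {y : Ambient n} (hy : y ∈ f.X) : Module.finrank ℝ (f.tangent y) = n := by
  set M : Ambient n →ₗ[ℝ] ℝ × ℝ :=
    (fderiv ℝ (cone (n := n)) y).toLinearMap.prod (fderiv ℝ f.toFun y).toLinearMap with hM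
  have hker : LinearMap.ker M = f.tangent y := LinearMap.ker_prod _ _
  have hsurj : Function.Surjective M := by
    rintro ⟨a, b⟩
    refine ⟨a • f.F y + (b - a * fderiv ℝ f.toFun y (f.F y)) • y, ?_⟩
    have h1 := f.fderiv_cone_F hy.1
    rw [hy.2.2] at h1
    simp [hM, h1, f.fderiv_cone_self hy, f.fderiv_self_of_mem hy]
  have h := M.finrank_range_add_finrank_ker
  rw [LinearMap.range_eq_top.2 hsurj, finrank_top, hker] at h
  simp at h
  omega

/-- Local parametrisations of `X_f`. -/
theorem exists_chart {x₀ : Ambient n} (hx₀ : x₀ ∈ f.X) :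
    ∃ (B : Set (Fin n → ℝ)) (σ : (Fin n → ℝ) → Ambient n) (u₀ : Fin n → ℝ), IsOpen B ∧ u₀ ∈ B ∧
      ContDiffOn ℝ ∞ σ B ∧ MapsTo σ B f.X ∧ σ u₀ = x₀ ∧ Function.Injective (fderiv ℝ σ u₀) := by
  set T := f.tangent x₀ with hT
  obtain ⟨P, hP⟩ := T.subtype.exists_leftInverse_of_injective T.ker_subtype
  let e : T ≃ₗ[ℝ] (Fin n → ℝ) := LinearEquiv.ofFinrankEq _ _ (by
    rw [f.finrank_tangent hx₀]
    simp)
  let L : Ambient n →L[ℝ] (Fin n → ℝ) := LinearMap.toContinuousLinearMap (e.toLinearMap ∘ₗ P)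
  -- `L` restricts to an isomorphism on the tangent space, which is the common kernel of `dc` and
  -- `df`; so `(c, f, L)` is a local diffeomorphism that takes `X_f` to the slice `(0, 1)`.
  let g : Ambient n → (ℝ × ℝ) × (Fin n → ℝ) := fun y => ((cone y, f.toFun y), L y)
  let g' : Ambient n →L[ℝ] (ℝ × ℝ) × (Fin n → ℝ) :=
    ((fderiv ℝ (cone (n := n)) x₀).prod (fderiv ℝ f.toFun x₀)).prod L
  have hginj : Function.Injective g' := by
    rw [injective_iff_map_eq_zero]
    intro v hv
    have h1 : v ∈ T := f.mem_tangent.2 ⟨congrArg (fun q : (ℝ × ℝ) × (Fin n → ℝ) => q.1.1) hv,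
      congrArg (fun q : (ℝ × ℝ) × (Fin n → ℝ) => q.1.2) hv⟩
    have h2 : e (P v) = 0 := congrArg Prod.snd hv
    have h3 : P v = ⟨v, h1⟩ := DFunLike.congr_fun hP (⟨v, h1⟩ : T)
    rw [h3, LinearEquiv.map_eq_zero_iff] at h2
    exact congrArg Subtype.val h2
  let G' : Ambient n ≃L[ℝ] (ℝ × ℝ) × (Fin n → ℝ) :=
    (LinearEquiv.ofInjectiveOfFinrankEq g'.toLinearMap hginj (by
      simp; omega)).toContinuousLinearEquiv
  have hgd : HasFDerivAt g (G' : Ambient n →L[ℝ] (ℝ × ℝ) × (Fin n → ℝ)) x₀ := by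
    have h1 := ((contDiff_cone (n := n)).differentiable (by simp) x₀).hasFDerivAt
    exact (h1.prodMk (f.differentiableAt hx₀.1).hasFDerivAt).prodMk L.hasFDerivAt
  have hgs : ContDiffOn ℝ ∞ g f.domain :=
    (contDiff_cone.contDiffOn.prodMk f.smooth).prodMk L.contDiff.contDiffOn
  obtain ⟨h, hxs, hsub, hh, hhs⟩ :=
    exists_openPartialHomeomorph_contDiffOn f.isOpen_domain hx₀.1 hgs G' hgd
  have hgx : g x₀ = ((0, 1), L x₀) := by simp [g, hx₀.2.1, hx₀.2.2]
  set B : Set (Fin n → ℝ) := (fun u => (((0 : ℝ), (1 : ℝ)), u)) ⁻¹' h.target with hB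
  have hBo : IsOpen B := h.open_target.preimage (by fun_prop)
  have hu₀ : L x₀ ∈ B := by
    rw [hB, mem_preimage, ← hgx, ← hh]
    exact h.map_source hxs
  have hσ : ContDiffOn ℝ ∞ (fun u => h.symm (((0 : ℝ), (1 : ℝ)), u)) B :=
    hhs.comp (by fun_prop) fun u hu => hu
  have hinv : ∀ u ∈ B, g (h.symm ((0, 1), u)) = ((0, 1), u) := fun u hu => by
    rw [← hh]
    exact h.right_inv hu
  refine ⟨B, fun u => h.symm ((0, 1), u), L x₀, hBo, hu₀, hσ, ?_, ?_, ?_⟩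
  · intro u hu
    have h1 := hinv u hu
    exact ⟨hsub (h.map_target hu), congrArg (fun q => q.1.1) h1, congrArg (fun q => q.1.2) h1⟩
  · dsimp only
    rw [← hgx, ← hh]
    exact h.left_inv hxs
  · have hd : HasFDerivAt (fun u => h.symm (((0 : ℝ), (1 : ℝ)), u)) _ (L x₀) :=
      ((hσ.contDiffAt (hBo.mem_nhds hu₀)).differentiableAt (by simp)).hasFDerivAt
    have h1 : HasFDerivAt (fun u => L (h.symm ((0, 1), u))) _ (L x₀) :=
      L.hasFDerivAt.comp (L x₀) hd
    have h2 : HasFDerivAt (fun u => L (h.symm ((0, 1), u))) (ContinuousLinearMap.id ℝ _) (L x₀) := by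
      refine (hasFDerivAt_id _).congr_of_eventuallyEq ?_
      filter_upwards [hBo.mem_nhds hu₀] with u hu using congrArg Prod.snd (hinv u hu)
    have h3 := h1.unique h2
    refine Function.LeftInverse.injective (g := L) fun w => ?_
    exact DFunLike.congr_fun h3 w

end DefiningFunction

end NullConeForms

/-! ### Flow boxes around points of `X_f` -/

namespace NullConeForms

variable {n : ℕ}

/-- `y` can be reached from `x` along a reparametrised integral curve of `V` in `U`. -/
def JoinedAlong (V : Ambient n → Ambient n) (U : Set (Ambient n)) (x y : Ambient n) : Prop :=
  ∃ (γ : ℝ → Ambient n) (c : ℝ → ℝ), γ 0 = x ∧ γ 1 = y ∧ ContinuousOn c (Icc 0 1) ∧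
    ∀ t ∈ Icc (0 : ℝ) 1, γ t ∈ U ∧ HasDerivAt γ (c t • V (γ t)) t

/-- Coordinates `(r, u)` on an open set `U`, of which `u` is constant along `D` and `V`, and `r` is
constant along `V`, equal to `1` on `X_f` and homogeneous of degree one; together with the inverse
`σ` of the restriction of `u` to `X_f`. -/
structure FlowBox (f : DefiningFunction n) (V : Ambient n → Ambient n) (U : Set (Ambient n)) where
  isOpen : IsOpen U
  subset_domain : U ⊆ f.domain
  ne_zero : ∀ y ∈ U, f.toFun y ≠ 0
  B : Set (Fin n → ℝ)
  isOpen_B : IsOpen B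
  σ : (Fin n → ℝ) → Ambient n
  contDiffOn_σ : ContDiffOn ℝ ∞ σ B
  mapsTo_σ : MapsTo σ B (f.X ∩ U)
  u : Ambient n → Fin n → ℝ
  contDiffOn_u : ContDiffOn ℝ ∞ u U
  mapsTo_u : MapsTo u U B
  r : Ambient n → ℝ
  contDiffOn_r : ContDiffOn ℝ ∞ r U
  r_pos : ∀ y ∈ U, 0 < r y
  fderiv_u_self : ∀ y ∈ U, fderiv ℝ u y y = 0
  fderiv_u_V : ∀ y ∈ U, fderiv ℝ u y (V y) = 0
  fderiv_r_self : ∀ y ∈ U, fderiv ℝ r y y = r y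
  fderiv_r_V : ∀ y ∈ U, fderiv ℝ r y (V y) = 0
  r_of_mem : ∀ y ∈ f.X ∩ U, r y = 1
  σ_u : ∀ y ∈ f.X ∩ U, σ (u y) = y
  fderiv_σ_fderiv_u : ∀ y ∈ f.X ∩ U, ∀ v ∈ f.tangent y, fderiv ℝ σ (u y) (fderiv ℝ u y v) = v
  joined : ∀ y ∈ U, ∃ x ∈ f.X ∩ U, ∃ z ∈ U, JoinedAlong dilation U x z ∧ JoinedAlong V U z y

/-- A function with nowhere vanishing derivative on an interval has at most one zero there. -/
lemma eq_zero_of_deriv_ne_zero {g g' : ℝ → ℝ} {t : ℝ} (h0 : g 0 = 0) (ht : g t = 0)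
    (hg : ∀ s, |s| ≤ |t| → HasDerivAt g (g' s) s ∧ g' s ≠ 0) : t = 0 := by
  by_contra hne
  rcases lt_or_gt_of_ne hne with h | h
  · have hs : ∀ s ∈ Icc t 0, |s| ≤ |t| := fun s hs => by
      rw [abs_of_nonpos hs.2, abs_of_neg h]
      linarith [hs.1]
    obtain ⟨s, hs1, hs2⟩ := exists_hasDerivAt_eq_zero h
      (fun s hs' => (hg s (hs s hs')).1.continuousAt.continuousWithinAt) (ht.trans h0.symm)
      (fun s hs' => (hg s (hs s (Ioo_subset_Icc_self hs'))).1)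
    exact (hg s (hs s (Ioo_subset_Icc_self hs1))).2 hs2
  · have hs : ∀ s ∈ Icc 0 t, |s| ≤ |t| := fun s hs => by
      rw [abs_of_nonneg hs.1, abs_of_pos h]
      exact hs.2
    obtain ⟨s, hs1, hs2⟩ := exists_hasDerivAt_eq_zero h
      (fun s hs' => (hg s (hs s hs')).1.continuousAt.continuousWithinAt) (h0.trans ht.symm)
      (fun s hs' => (hg s (hs s (Ioo_subset_Icc_self hs'))).1)
    exact (hg s (hs s (Ioo_subset_Icc_self hs1))).2 hs2

/-- The box coordinates: a scale, a time and a point of the parameter domain. -/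
abbrev BoxCoord (n : ℕ) : Type := ℝ × ℝ × (Fin n → ℝ)

/-- Points of `X_f` have arbitrarily small flow boxes. -/
theorem DefiningFunction.exists_flowBox (f : DefiningFunction n) {V : Ambient n → Ambient n}
    {d : ℕ} (hV : f.IsTransversal V d) {x₀ : Ambient n} (hx₀ : x₀ ∈ f.X) {N : Set (Ambient n)}
    (hN : N ∈ 𝓝 x₀) : ∃ U : Set (Ambient n), x₀ ∈ U ∧ U ⊆ N ∧ Nonempty (FlowBox f V U) := by
  obtain ⟨B₀, σ, u₀, hB₀, hu₀, hσ, hσX, hσu₀, hσinj⟩ := f.exists_chart hx₀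
  obtain ⟨S, φ, hS, hx₀S, hφ, hφΩ, hφ0, hφd⟩ :=
    exists_smooth_local_flow f.isOpen_domain hV.smooth hx₀.1
  -- the open set on which the target conditions hold
  set N' : Set (Ambient n) := f.domain ∩ f.toFun ⁻¹' {0}ᶜ ∩ _root_.interior N with hN'
  have hN'o : IsOpen N' :=
    (f.smooth.continuousOn.isOpen_inter_preimage f.isOpen_domain isOpen_compl_singleton).inter
      isOpen_interior
  have hx₀N' : x₀ ∈ N' := by
    refine ⟨⟨hx₀.1, ?_⟩, mem_interior_iff_mem_nhds.2 hN⟩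
    simp [hx₀.2.2]
  -- Where `dc(V) ≠ 0`, the function `c` is injective along flow lines, so a flow line in the box
  -- meets the cone only at time 0.
  set P : Set (Ambient n) :=
    f.domain ∩ (fun y => fderiv ℝ (cone (n := n)) y (V y)) ⁻¹' {0}ᶜ with hP
  have hPo : IsOpen P := by
    refine ContinuousOn.isOpen_inter_preimage ?_ f.isOpen_domain isOpen_compl_singleton
    refine ContinuousOn.clm_apply ?_ hV.smooth.continuousOn
    exact ((contDiff_cone (n := n)).continuous_fderiv (by simp)).continuousOn
  have hx₀P : x₀ ∈ P := ⟨hx₀.1, by simp [hV.fderiv_cone x₀ hx₀]⟩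
  -- the parametrisation
  set flow : BoxCoord n → Ambient n := fun q => φ (q.2.1, σ q.2.2) with hflow
  -- Flow first, then rescale: homogeneity of `V` keeps both fields proportional to coordinate
  -- fields.
  set Ψ : BoxCoord n → Ambient n := fun q => q.1 • flow q with hΨ
  set Q₀ : Set (BoxCoord n) := {q | q.2.2 ∈ B₀} with hQ₀
  have hQ₀o : IsOpen Q₀ := hB₀.preimage (by fun_prop)
  have hpair : ContDiffOn ℝ ∞ (fun q : BoxCoord n => (q.2.1, σ q.2.2)) Q₀ :=
    (contDiff_fst.comp contDiff_snd).contDiffOn.prodMk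
      (hσ.comp (contDiff_snd.comp contDiff_snd).contDiffOn fun q hq => hq)
  set Q₁ : Set (BoxCoord n) := Q₀ ∩ (fun q => (q.2.1, σ q.2.2)) ⁻¹' S with hQ₁
  have hQ₁o : IsOpen Q₁ := hpair.continuousOn.isOpen_inter_preimage hQ₀o hS
  have hflows : ContDiffOn ℝ ∞ flow Q₁ :=
    hφ.comp (hpair.mono inter_subset_left) fun q hq => hq.2
  set Q₂ : Set (BoxCoord n) := Q₁ ∩ flow ⁻¹' P with hQ₂
  have hQ₂o : IsOpen Q₂ := hflows.continuousOn.isOpen_inter_preimage hQ₁o hPo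
  have hΨs₂ : ContDiffOn ℝ ∞ Ψ Q₂ :=
    contDiff_fst.contDiffOn.smul (hflows.mono inter_subset_left)
  set Q₃ : Set (BoxCoord n) := Q₂ ∩ Ψ ⁻¹' N' with hQ₃
  have hQ₃o : IsOpen Q₃ := hΨs₂.continuousOn.isOpen_inter_preimage hQ₂o hN'o
  set Q : Set (BoxCoord n) := Q₃ ∩ {q | 0 < q.1} with hQ
  have hQo : IsOpen Q := hQ₃o.inter (isOpen_lt continuous_const continuous_fst)
  have hΨs : ContDiffOn ℝ ∞ Ψ Q := hΨs₂.mono fun q hq => hq.1.1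
  have hS_of : ∀ q ∈ Q, (q.2.1, σ q.2.2) ∈ S := fun q hq => hq.1.1.1.2
  have hflowΩ : ∀ q ∈ Q, flow q ∈ f.domain := fun q hq => hφΩ (hS_of q hq)
  set q₀ : BoxCoord n := (1, 0, u₀) with hq₀
  have hflow0 : flow q₀ = x₀ := by
    simp only [hflow, hq₀, hσu₀]
    exact hφ0 _ hx₀S
  have hΨ0 : Ψ q₀ = x₀ := by
    change (1 : ℝ) • flow q₀ = x₀
    rw [one_smul, hflow0]
  have hq₀Q : q₀ ∈ Q := by
    refine ⟨⟨⟨⟨hu₀, ?_⟩, ?_⟩, ?_⟩, by simp [hq₀]⟩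
    · simpa [hq₀, hσu₀] using hx₀S
    · rw [mem_preimage, hflow0]
      exact hx₀P
    · rw [mem_preimage, hΨ0]
      exact hx₀N'
  -- partial derivatives of the parametrisation
  have hΨd : ∀ q ∈ Q, HasFDerivAt Ψ (fderiv ℝ Ψ q) q := fun q hq =>
    ((hΨs.contDiffAt (hQo.mem_nhds hq)).differentiableAt (by simp)).hasFDerivAt
  have hΨ1 : ∀ q ∈ Q, fderiv ℝ Ψ q (1, 0, 0) = flow q := by
    rintro ⟨l, t, u⟩ hq
    have h1 : HasDerivAt (fun s : ℝ => ((s, t, u) : BoxCoord n)) (1, 0, 0) l :=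
      (hasDerivAt_id l).prodMk (hasDerivAt_const l (t, u))
    have h2 := (hΨd _ hq).comp_hasDerivAt l h1
    have h3 : HasDerivAt (fun s : ℝ => s • φ (t, σ u)) (φ (t, σ u)) l := by
      simpa using (hasDerivAt_id l).smul_const (φ (t, σ u))
    exact h2.unique h3
  have hΨ2 : ∀ q ∈ Q, fderiv ℝ Ψ q (0, 1, 0) = q.1 • V (flow q) := by
    rintro ⟨l, t, u⟩ hq
    have h1 : HasDerivAt (fun s : ℝ => ((l, s, u) : BoxCoord n)) (0, 1, 0) t :=
      (hasDerivAt_const t l).prodMk ((hasDerivAt_id t).prodMk (hasDerivAt_const t u))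
    have h2 := (hΨd _ hq).comp_hasDerivAt t h1
    have h3 : HasDerivAt (fun s : ℝ => l • φ (s, σ u)) (l • V (φ (t, σ u))) t :=
      (hφd t (σ u) (hS_of _ hq)).const_smul l
    exact h2.unique h3
  have hΨ3 : ∀ u w, ((1, 0, u) : BoxCoord n) ∈ Q →
      fderiv ℝ Ψ (1, 0, u) (0, 0, w) = fderiv ℝ σ u w := by
    intro u w hq
    have h1 : HasFDerivAt (fun s => ((1, 0, s) : BoxCoord n))
        ((0 : (Fin n → ℝ) →L[ℝ] ℝ).prod ((0 : (Fin n → ℝ) →L[ℝ] ℝ).prod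
          (ContinuousLinearMap.id ℝ _))) u :=
      (hasFDerivAt_const (1 : ℝ) u).prodMk ((hasFDerivAt_const (0 : ℝ) u).prodMk (hasFDerivAt_id u))
    have h2 := (hΨd _ hq).comp u h1
    have h3 : HasFDerivAt σ (fderiv ℝ σ u) u :=
      ((hσ.contDiffAt (hB₀.mem_nhds hq.1.1.1.1)).differentiableAt (by simp)).hasFDerivAt
    have h4 : (fun s => Ψ (1, 0, s)) =ᶠ[𝓝 u] σ := by
      have h5 : (fun s => ((1, 0, s) : BoxCoord n)) ⁻¹' Q ∈ 𝓝 u :=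
        (hQo.preimage (by fun_prop)).mem_nhds hq
      filter_upwards [h5] with s hs
      simp only [hΨ, hflow, one_smul]
      exact hφ0 _ (hS_of _ hs)
    have h6 := (h3.congr_of_eventuallyEq h4).unique h2
    exact (DFunLike.congr_fun h6 w).symm
  have hΨX : ∀ u, ((1, 0, u) : BoxCoord n) ∈ Q → Ψ (1, 0, u) = σ u := by
    intro u hu
    simp only [hΨ, hflow, one_smul]
    exact hφ0 _ (hS_of _ hu)
  -- at the points of `X_f`, the time and scale components of tangent vectors vanish
  have hsplit : ∀ u, ((1, 0, u) : BoxCoord n) ∈ Q → ∀ a b w,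
      fderiv ℝ Ψ (1, 0, u) (a, b, w) ∈ f.tangent (σ u) → a = 0 ∧ b = 0 := by
    intro u hu a b w hv
    have hX : σ u ∈ f.X := hσX hu.1.1.1.1
    have hdec : ((a, b, w) : BoxCoord n) = a • (1, 0, 0) + b • (0, 1, 0) + (0, 0, w) := by
      ext <;> simp
    have hfl : flow (1, 0, u) = σ u := by
      have := hΨX u hu
      simpa [hΨ] using this
    have hσw : fderiv ℝ σ u w ∈ f.tangent (σ u) := fderiv_mem_tangent hB₀ hσ hσX hu.1.1.1.1 w
    rw [hdec, map_add, map_add, map_smul, map_smul, hΨ1 _ hu, hΨ2 _ hu, hΨ3 _ _ hu, hfl,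
      one_smul] at hv
    have hv' := (Submodule.add_mem_iff_left _ hσw).1 hv
    obtain ⟨hc, hf⟩ := f.mem_tangent.1 hv'
    rw [map_add, map_smul, map_smul, f.fderiv_cone_self hX, hV.fderiv_cone _ hX] at hc
    have hb : b = 0 := by simpa using hc
    rw [hb, zero_smul, add_zero, map_smul, f.fderiv_self_of_mem hX] at hf
    exact ⟨by simpa using hf, hb⟩
  have hinj : Function.Injective (fderiv ℝ Ψ q₀) := by
    rw [injective_iff_map_eq_zero]
    rintro ⟨a, b, w⟩ hv
    obtain ⟨rfl, rfl⟩ := hsplit u₀ hq₀Q a b w (by rw [← hq₀, hv]; exact zero_mem _)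
    rw [hΨ3 _ _ hq₀Q] at hv
    rw [(injective_iff_map_eq_zero _).1 hσinj w hv]
    rfl
  let Ψ' : BoxCoord n ≃L[ℝ] Ambient n :=
    (LinearEquiv.ofInjectiveOfFinrankEq (fderiv ℝ Ψ q₀).toLinearMap hinj (by
      simp; omega)).toContinuousLinearEquiv
  obtain ⟨e, hq₀e, heQ, heΨ, hes⟩ := exists_openPartialHomeomorph_contDiffOn hQo hq₀Q hΨs Ψ'
    (by exact hΨd q₀ hq₀Q)
  obtain ⟨ε, hε, hball⟩ := Metric.isOpen_iff.1 e.open_source q₀ hq₀e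
  have hbQ : ∀ q ∈ Metric.ball q₀ ε, q ∈ Q := fun q hq => heQ (hball hq)
  have hbmem : ∀ q : BoxCoord n, q ∈ Metric.ball q₀ ε ↔
      |q.1 - 1| < ε ∧ |q.2.1| < ε ∧ q.2.2 ∈ Metric.ball u₀ ε := by
    intro q
    rw [Metric.mem_ball, Prod.dist_eq, max_lt_iff, Prod.dist_eq, max_lt_iff, Real.dist_eq,
      Real.dist_eq, sub_zero, Metric.mem_ball]
  -- For the product metric this ball is a product of intervals and a ball, so the coordinate
  -- segments in `l` and `t` used below stay inside.
  set U : Set (Ambient n) := Ψ '' Metric.ball q₀ ε with hU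
  have hUe : U = e '' Metric.ball q₀ ε := image_congr fun q _ => (heΨ q).symm
  have hUo : IsOpen U := by
    rw [hUe]
    exact e.isOpen_image_of_subset_source Metric.isOpen_ball hball
  have hUt : U ⊆ e.target := by
    rw [hUe]
    rintro _ ⟨q, hq, rfl⟩
    exact e.map_source (hball hq)
  have hleft : ∀ q ∈ Metric.ball q₀ ε, e.symm (Ψ q) = q := fun q hq => by
    rw [← heΨ]
    exact e.left_inv (hball hq)
  have hesd : ∀ y ∈ U, HasFDerivAt e.symm (fderiv ℝ e.symm y) y := fun y hy =>
    (((hes.mono hUt).contDiffAt (hUo.mem_nhds hy)).differentiableAt (by simp)).hasFDerivAt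
  have hdl : ∀ q ∈ Metric.ball q₀ ε, ∀ w, fderiv ℝ e.symm (Ψ q) (fderiv ℝ Ψ q w) = w := by
    intro q hq w
    have h1 := (hesd _ (mem_image_of_mem Ψ hq)).comp q (hΨd q (hbQ q hq))
    have h2 : HasFDerivAt (e.symm ∘ Ψ) (ContinuousLinearMap.id ℝ _) q := by
      refine (hasFDerivAt_id q).congr_of_eventuallyEq ?_
      filter_upwards [Metric.isOpen_ball.mem_nhds hq] with z hz using hleft z hz
    exact DFunLike.congr_fun (h1.unique h2) w
  have hdr : ∀ q ∈ Metric.ball q₀ ε, ∀ v, fderiv ℝ Ψ q (fderiv ℝ e.symm (Ψ q) v) = v := by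
    intro q hq v
    have h0 : HasFDerivAt Ψ (fderiv ℝ Ψ q) (e.symm (Ψ q)) := by
      rw [hleft q hq]
      exact hΨd q (hbQ q hq)
    have h1 := h0.comp (Ψ q) (hesd _ (mem_image_of_mem Ψ hq))
    have h2 : HasFDerivAt (Ψ ∘ e.symm) (ContinuousLinearMap.id ℝ _) (Ψ q) := by
      refine (hasFDerivAt_id _).congr_of_eventuallyEq ?_
      filter_upwards [hUo.mem_nhds (mem_image_of_mem Ψ hq)] with z hz
      have := e.right_inv (hUt hz)
      rwa [heΨ] at this
    exact DFunLike.congr_fun (h1.unique h2) v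
  -- derivatives of the inverse along the two vector fields
  have hself : ∀ q ∈ Metric.ball q₀ ε, fderiv ℝ e.symm (Ψ q) (Ψ q) = (q.1, 0, 0) := by
    intro q hq
    have h1 : Ψ q = fderiv ℝ Ψ q (q.1, 0, 0) := by
      have h2 : ((q.1, 0, 0) : BoxCoord n) = q.1 • (1, 0, 0) := by ext <;> simp
      rw [h2, map_smul, hΨ1 q (hbQ q hq)]
    have h3 := hdl q hq (q.1, 0, 0)
    rwa [← h1] at h3
  have hVV : ∀ q ∈ Metric.ball q₀ ε,
      fderiv ℝ e.symm (Ψ q) (V (Ψ q)) = (0, q.1 ^ d * q.1⁻¹, 0) := by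
    intro q hq
    have hpos : 0 < q.1 := (hbQ q hq).2
    have h1 : V (Ψ q) = fderiv ℝ Ψ q (0, q.1 ^ d * q.1⁻¹, 0) := by
      have h2 : ((0, q.1 ^ d * q.1⁻¹, 0) : BoxCoord n) = (q.1 ^ d * q.1⁻¹) • (0, 1, 0) := by
        ext <;> simp
      rw [h2, map_smul, hΨ2 q (hbQ q hq), smul_smul, mul_assoc, inv_mul_cancel₀ hpos.ne', mul_one]
      exact hV.homogeneous _ (hflowΩ q (hbQ q hq)) _ hpos
    rw [h1]
    exact hdl q hq _
  have hfst : ∀ y ∈ U, ∀ v, fderiv ℝ (fun y => (e.symm y).1) y v = (fderiv ℝ e.symm y v).1 :=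
    fun y hy v => by rw [(hesd y hy).fst.fderiv]; rfl
  have hsnd : ∀ y ∈ U, ∀ v, fderiv ℝ (fun y => (e.symm y).2.2) y v = (fderiv ℝ e.symm y v).2.2 :=
    fun y hy v => by rw [(hesd y hy).snd.snd.fderiv]; rfl
  have hslice : ∀ u ∈ Metric.ball u₀ ε, ((1, 0, u) : BoxCoord n) ∈ Metric.ball q₀ ε :=
    fun u hu => (hbmem _).2 ⟨by simpa using hε, by simpa using hε, hu⟩
  -- the points of `X_f` in the box
  have hXU : ∀ q ∈ Metric.ball q₀ ε, Ψ q ∈ f.X → q = (1, 0, q.2.2) := by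
    rintro ⟨l, t, u⟩ hq hX
    obtain ⟨hl, ht, hu⟩ := (hbmem _).1 hq
    have hqQ := hbQ _ hq
    have hpos : 0 < l := hqQ.2
    have hmem : ∀ s, |s| ≤ |t| → ((l, s, u) : BoxCoord n) ∈ Q := fun s hs =>
      hbQ _ ((hbmem _).2 ⟨hl, hs.trans_lt ht, hu⟩)
    have hσuX : σ u ∈ f.X := hσX hqQ.1.1.1.1
    have hφ0u : φ (0, σ u) = σ u := hφ0 _ (hS_of _ (hmem 0 (by simp)))
    have ht0 : t = 0 := by
      refine eq_zero_of_deriv_ne_zero (g := fun s => cone (φ (s, σ u)))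
        (g' := fun s => fderiv ℝ (cone (n := n)) (φ (s, σ u)) (V (φ (s, σ u)))) ?_ ?_ ?_
      · rw [hφ0u]
        exact hσuX.2.1
      · have h1 : cone (l • φ (t, σ u)) = 0 := hX.2.1
        rw [cone_smul] at h1
        exact (mul_eq_zero.1 h1).resolve_left (pow_ne_zero 2 hpos.ne')
      · intro s hs
        have hsQ := hmem s hs
        refine ⟨?_, hsQ.1.1.2.2⟩
        exact ((contDiff_cone (n := n)).differentiable (by simp) _).hasFDerivAt.comp_hasDerivAt s
          (hφd s (σ u) (hS_of _ hsQ))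
    subst ht0
    have hl1 : f.toFun (l • φ (0, σ u)) = 1 := hX.2.2
    rw [hφ0u, f.homogeneous _ hσuX.1 l hpos, hσuX.2.2, mul_one] at hl1
    rw [hl1]
  refine ⟨U, ⟨q₀, Metric.mem_ball_self hε, hΨ0⟩, ?_, ⟨{
    isOpen := hUo
    subset_domain := ?_
    ne_zero := ?_
    B := Metric.ball u₀ ε
    isOpen_B := Metric.isOpen_ball
    σ := σ
    contDiffOn_σ := hσ.mono fun u hu => (hbQ _ (hslice u hu)).1.1.1.1
    mapsTo_σ := ?_
    u := fun y => (e.symm y).2.2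
    contDiffOn_u := contDiff_snd.comp_contDiffOn (contDiff_snd.comp_contDiffOn (hes.mono hUt))
    mapsTo_u := ?_
    r := fun y => (e.symm y).1
    contDiffOn_r := contDiff_fst.comp_contDiffOn (hes.mono hUt)
    r_pos := ?_
    fderiv_u_self := ?_
    fderiv_u_V := ?_
    fderiv_r_self := ?_
    fderiv_r_V := ?_
    r_of_mem := ?_
    σ_u := ?_
    fderiv_σ_fderiv_u := ?_
    joined := ?_ }⟩⟩
  · rintro _ ⟨q, hq, rfl⟩
    exact interior_subset (hbQ q hq).1.2.2
  · rintro _ ⟨q, hq, rfl⟩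
    exact (hbQ q hq).1.2.1.1
  · rintro _ ⟨q, hq, rfl⟩
    exact (hbQ q hq).1.2.1.2
  · intro u hu
    exact ⟨hσX (hbQ _ (hslice u hu)).1.1.1.1, (1, 0, u), hslice u hu, hΨX u (hbQ _ (hslice u hu))⟩
  · rintro _ ⟨q, hq, rfl⟩
    dsimp only
    rw [hleft q hq]
    exact ((hbmem q).1 hq).2.2
  · rintro _ ⟨q, hq, rfl⟩
    rw [hleft q hq]
    exact (hbQ q hq).2
  · rintro _ ⟨q, hq, rfl⟩
    rw [hsnd _ (mem_image_of_mem Ψ hq), hself q hq]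
  · rintro _ ⟨q, hq, rfl⟩
    rw [hsnd _ (mem_image_of_mem Ψ hq), hVV q hq]
  · rintro _ ⟨q, hq, rfl⟩
    rw [hfst _ (mem_image_of_mem Ψ hq), hself q hq, hleft q hq]
  · rintro _ ⟨q, hq, rfl⟩
    rw [hfst _ (mem_image_of_mem Ψ hq), hVV q hq]
  · rintro _ ⟨hX, q, hq, rfl⟩
    rw [hleft q hq, hXU q hq hX]
  · rintro _ ⟨hX, q, hq, rfl⟩
    rw [hleft q hq]
    have h1 := hXU q hq hX
    rw [h1]
    exact (hΨX _ (by rw [← h1]; exact hbQ q hq)).symm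
  · rintro _ ⟨hX, q, hq, rfl⟩ v hv
    rw [hsnd _ (mem_image_of_mem Ψ hq), hleft q hq]
    have h1 := hXU q hq hX
    generalize q.2.2 = u at h1
    subst h1
    have huQ := hbQ _ hq
    have h2 := hdr _ hq v
    rw [hΨX u huQ] at hv h2 ⊢
    generalize fderiv ℝ e.symm (σ u) v = z at h2 ⊢
    obtain ⟨a, b, w⟩ := z
    obtain ⟨rfl, rfl⟩ := hsplit u huQ a b w (by rw [h2]; exact hv)
    rw [← hΨ3 u w huQ]
    exact h2
  · rintro _ ⟨⟨l, t, u⟩, hq, rfl⟩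
    obtain ⟨hl, ht, hu⟩ := (hbmem _).1 hq
    have hpos : 0 < l := (hbQ _ hq).2
    have hmem1 : ∀ s ∈ Icc (0 : ℝ) 1, ((1 + s * (l - 1), 0, u) : BoxCoord n) ∈ Metric.ball q₀ ε := by
      intro s hs
      refine (hbmem _).2 ⟨?_, by simpa using hε, hu⟩
      rw [add_sub_cancel_left, abs_mul, abs_of_nonneg hs.1]
      exact (mul_le_of_le_one_left (abs_nonneg _) hs.2).trans_lt hl
    have hmem2 : ∀ s ∈ Icc (0 : ℝ) 1, ((l, s * t, u) : BoxCoord n) ∈ Metric.ball q₀ ε := by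
      intro s hs
      refine (hbmem _).2 ⟨hl, ?_, hu⟩
      rw [abs_mul, abs_of_nonneg hs.1]
      exact (mul_le_of_le_one_left (abs_nonneg _) hs.2).trans_lt ht
    have hpos1 : ∀ s ∈ Icc (0 : ℝ) 1, 0 < 1 + s * (l - 1) := fun s hs => (hbQ _ (hmem1 s hs)).2
    refine ⟨Ψ (1, 0, u), ⟨?_, mem_image_of_mem _ (hslice u hu)⟩, Ψ (l, 0, u),
      mem_image_of_mem _ (by simpa using hmem2 0 (by simp)), ?_, ?_⟩
    · rw [hΨX u (hbQ _ (hslice u hu))]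
      exact hσX (hbQ _ (hslice u hu)).1.1.1.1
    -- The velocity `(l - 1) φ(0, σ u)` is rewritten as a multiple of the position, which is `D` at
    -- that point.
    · refine ⟨fun s => Ψ (1 + s * (l - 1), 0, u), fun s => (l - 1) * (1 + s * (l - 1))⁻¹,
        by simp, by simp, ?_, fun s hs => ⟨mem_image_of_mem _ (hmem1 s hs), ?_⟩⟩
      · exact continuousOn_const.mul (ContinuousOn.inv₀ (by fun_prop) fun s hs => (hpos1 s hs).ne')
      · have h1 : HasDerivAt (fun s : ℝ => 1 + s * (l - 1)) (l - 1) s := by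
          simpa using ((hasDerivAt_id s).mul_const (l - 1)).const_add 1
        have h2 := h1.smul_const (φ (0, σ u))
        refine h2.congr_deriv ?_
        simp only [dilation, hΨ, hflow, smul_smul]
        rw [mul_assoc, inv_mul_cancel₀ (hpos1 s hs).ne', mul_one]
    -- The velocity is `t l V(φ)`, and `V(φ) = l^(-d) V(Ψ)` by homogeneity.
    · refine ⟨fun s => Ψ (l, s * t, u), fun _ => t * (l * (l ^ d)⁻¹), by simp, by simp,
        continuousOn_const, fun s hs => ⟨mem_image_of_mem _ (hmem2 s hs), ?_⟩⟩
      have hsQ := hbQ _ (hmem2 s hs)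
      have h1 : HasDerivAt (fun s : ℝ => s * t) t s := by
        simpa using (hasDerivAt_id s).mul_const t
      have h2 := ((hφd (s * t) (σ u) (hS_of _ hsQ)).scomp s h1).const_smul l
      refine h2.congr_deriv ?_
      have h3 : V (Ψ (l, s * t, u)) = l ^ d • V (φ (s * t, σ u)) :=
        hV.homogeneous _ (hflowΩ _ hsQ) _ hpos
      rw [h3, smul_smul, smul_smul, mul_assoc, mul_assoc l, inv_mul_cancel₀ (pow_ne_zero d hpos.ne'),
        mul_one, mul_comm]

end NullConeForms

/-! ### Smooth families of alternating forms and pointwise algebra -/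

namespace NullConeForms

variable {n : ℕ}

/-- A family of alternating forms is smooth if its components are. -/
lemma contDiffOn_alternating {E : Type*} [NormedAddCommGroup E] [NormedSpace ℝ E] {a m : ℕ}
    {S : Set E} {b : E → (Fin m → ℝ) [⋀^Fin a]→L[ℝ] ℝ}
    (hb : ∀ w, ContDiffOn ℝ ∞ (fun x => b x w) S) : ContDiffOn ℝ ∞ b S := by
  let ev : ((Fin m → ℝ) [⋀^Fin a]→L[ℝ] ℝ) →ₗ[ℝ] ((Fin a → Fin m) → ℝ) :=
    { toFun := fun θ s => θ fun i => Pi.single (s i) 1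
      map_add' := fun _ _ => rfl
      map_smul' := fun _ _ => rfl }
  have hev : Function.Injective ev := by
    intro θ η h
    refine ContinuousAlternatingMap.toAlternatingMap_injective ?_
    refine Module.Basis.ext_alternating (Pi.basisFun ℝ (Fin m)) fun s _ => ?_
    simp only [Pi.basisFun_apply]
    exact congrFun h s
  -- Values on basis vectors determine a form; a linear left inverse, continuous by finite
  -- dimension, recovers `b` smoothly from its components.
  obtain ⟨L, hL⟩ := ev.exists_leftInverse_of_injective (LinearMap.ker_eq_bot.2 hev)
  have h : ∀ x, b x = LinearMap.toContinuousLinearMap L (ev (b x)) := fun x =>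
    (DFunLike.congr_fun hL (b x)).symm
  rw [show b = fun x => LinearMap.toContinuousLinearMap L (ev (b x)) from funext h]
  refine (LinearMap.toContinuousLinearMap L).contDiff.comp_contDiffOn ?_
  exact contDiffOn_pi.2 fun s => hb _

lemma contDiffOn_alternating_apply {E : Type*} [NormedAddCommGroup E] [NormedSpace ℝ E] {a m : ℕ}
    {S : Set E} {b : E → (Fin m → ℝ) [⋀^Fin a]→L[ℝ] ℝ} {v : E → Fin a → Fin m → ℝ}
    (hb : ContDiffOn ℝ ∞ b S) (hv : ∀ i, ContDiffOn ℝ ∞ (fun x => v x i) S) :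
    ContDiffOn ℝ ∞ (fun x => b x (v x)) S := by
  have h : ∀ x, b x (v x) = ∑ s : Fin a → Fin m,
      (∏ i, v x i (s i)) * b x fun i => Pi.single (s i) 1 := by
    intro x
    have h1 : v x = fun i => ∑ j : Fin m, v x i j • (Pi.single j (1 : ℝ) : Fin m → ℝ) := by
      funext i
      exact pi_eq_sum_univ' (v x i)
    conv_lhs => rw [h1]
    refine ((b x).toMultilinearMap.map_sum
      (fun i j => v x i j • (Pi.single j (1 : ℝ) : Fin m → ℝ))).trans
        (Finset.sum_congr rfl fun s _ => ?_)
    exact (b x).toMultilinearMap.map_smul_univ _ _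
  simp_rw [h]
  refine ContDiffOn.sum fun s _ => ContDiffOn.mul (contDiffOn_prod fun i _ => ?_) ?_
  · exact contDiffOn_pi.1 (hv i) (s i)
  · exact (ContinuousAlternatingMap.apply ℝ (Fin m → ℝ) ℝ
      (fun i => (Pi.single (s i) 1 : Fin m → ℝ))).contDiff.comp_contDiffOn hb

section Pointwise

variable {a : ℕ}

/-- `interior` fills only the first slot; a transposition brings any other slot there at the cost of
a sign. -/
lemma apply_eq_zero_of_interior_eq_zero {w : Ambient n} {θ : Alt n a} (h : interior w θ = 0)
    {v : Fin a → Ambient n} {i : Fin a} (hi : v i = w) : θ v = 0 := by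
  cases a with
  | zero => exact i.elim0
  | succ k =>
    have h1 : ∀ v : Fin (k + 1) → Ambient n, v 0 = w → θ v = 0 := by
      intro v hv
      have h2 := DFunLike.congr_fun h (Fin.tail v)
      rw [← Fin.cons_self_tail v, hv]
      exact h2
    by_cases hi0 : i = 0
    · exact h1 v (hi0 ▸ hi)
    · have h3 := θ.toAlternatingMap.map_swap v hi0
      have h4 : θ (v ∘ Equiv.swap i 0) = 0 := h1 _ (by simp [hi])
      have h5 : θ (v ∘ Equiv.swap i 0) = -θ v := h3
      rw [h4] at h5
      linarith

lemma interior_eq_zero {w : Ambient n} {θ : Alt n a}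
    (h : ∀ (v : Fin a → Ambient n) (i : Fin a), v i = w → θ v = 0) : interior w θ = 0 := by
  cases a with
  | zero => rfl
  | succ k =>
    ext v
    exact h (Fin.cons w v) 0 rfl

/-- The value of a form only depends on its arguments modulo its kernel. -/
lemma apply_eq_of_sub_mem_ker (θ : Alt n a) (v w : Fin a → Ambient n)
    (h : ∀ (m : Fin a → Ambient n) i, θ (Function.update m i (v i - w i)) = 0) : θ v = θ w := by
  -- Arguments are replaced one at a time; `s` is the set of those already replaced.
  have key : ∀ s : Finset (Fin a), θ (s.piecewise w v) = θ v := by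
    intro s
    induction s using Finset.induction_on with
    | empty => simp
    | insert j s hj ih =>
      rw [Finset.piecewise_insert, ← ih]
      have h1 : s.piecewise w v = Function.update (s.piecewise w v) j (v j) := by
        rw [eq_comm, Function.update_eq_self_iff, Finset.piecewise_eq_of_notMem _ _ _ hj]
      have h2 := θ.map_update_sub (s.piecewise w v) j (v j) (w j)
      rw [h, ← h1] at h2
      linarith
  rw [← key Finset.univ, Finset.piecewise_univ]

variable {f : DefiningFunction n}

/-- A transverse form at a point of `X_f` is determined by its restriction to tangent vectors. -/
lemma eq_of_eqOn_tangent {y : Ambient n} (hy : y ∈ f.X) {θ η : Alt n a}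
    (hθD : interior y θ = 0) (hθF : interior (f.F y) θ = 0)
    (hηD : interior y η = 0) (hηF : interior (f.F y) η = 0)
    (h : ∀ v : Fin a → f.tangent y, θ (fun i => (v i : Ambient n)) = η fun i => (v i : Ambient n)) :
    θ = η := by
  have hcF := f.fderiv_cone_F hy.1
  rw [hy.2.2] at hcF
  -- The coefficients are forced by `dc(D) = 0`, `dc(F) = 1` and `df(D) = 1`.
  have hdec : ∀ v : Ambient n, ∃ (t : f.tangent y) (p q : ℝ), v - t = p • y + q • f.F y := by
    intro v
    set q := fderiv ℝ (cone (n := n)) y v with hq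
    set p := fderiv ℝ f.toFun y v - q * fderiv ℝ f.toFun y (f.F y) with hp
    refine ⟨⟨v - (p • y + q • f.F y), f.mem_tangent.2 ⟨?_, ?_⟩⟩, p, q, by simp⟩
    · rw [map_sub, map_add, map_smul, map_smul, f.fderiv_cone_self hy, hcF, ← hq]
      simp
    · rw [map_sub, map_add, map_smul, map_smul, f.fderiv_self_of_mem hy, hp]
      simp
  choose t p q htpq using hdec
  have hred : ∀ ζ : Alt n a, interior y ζ = 0 → interior (f.F y) ζ = 0 → ∀ v : Fin a → Ambient n,
      ζ v = ζ fun i => (t (v i) : Ambient n) := by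
    intro ζ hD hF v
    refine apply_eq_of_sub_mem_ker ζ v _ fun m i => ?_
    rw [htpq, ζ.map_update_add, ζ.map_update_smul, ζ.map_update_smul,
      apply_eq_zero_of_interior_eq_zero hD (Function.update_self i _ m),
      apply_eq_zero_of_interior_eq_zero hF (Function.update_self i _ m)]
    simp
  ext v
  rw [hred θ hθD hθF, hred η hηD hηF]
  exact h fun i => t (v i)

/-- The type of the arguments depends on the base point; this compares values at points that are
only propositionally equal, such as `σ (u y)` and `y`. -/
lemma SpacetimeForm.apply_congr {U : Set (Ambient n)} (β : SpacetimeForm f U a)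
    {y z : ↥(f.X ∩ U)} (hyz : y = z) {v : Fin a → f.tangent (y : Ambient n)}
    {w : Fin a → f.tangent (z : Ambient n)} (h : ∀ i, (v i : Ambient n) = w i) :
    β.toFun y v = β.toFun z w := by
  subst hyz
  congr 1
  funext i
  exact Subtype.ext (h i)

@[ext]
lemma SpacetimeForm.ext {U : Set (Ambient n)} {β γ : SpacetimeForm f U a}
    (h : ∀ y v, β.toFun y v = γ.toFun y v) : β = γ := by
  cases β
  cases γ
  congr
  funext y
  ext v
  exact h y v

lemma AmbientForm.ext_of_eqOn {U : Set (Ambient n)} {θ η : AmbientForm n U a}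
    (h : EqOn θ.toFun η.toFun U) : θ = η := by
  have h1 : θ.toFun = η.toFun := by
    funext x
    by_cases hx : x ∈ U
    · exact h hx
    · rw [θ.eq_zero_off x hx, η.eq_zero_off x hx]
  cases θ
  cases η
  congr

/-- The restriction of a form on `X_f ∩ U` to a smaller open part of `X_f`. -/
def SpacetimeForm.restrict {U U' : Set (Ambient n)} (h : U' ⊆ U) (β : SpacetimeForm f U a) :
    SpacetimeForm f U' a where
  toFun y := β.toFun ⟨y, y.2.1, h y.2.2⟩
  smooth V φ hV hφ hX w := β.smooth V φ hV hφ (fun _ hu => ⟨(hX hu).1, h (hX hu).2⟩) w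

/-- Restriction to tangent vectors and transversality fix the whole ambient form at points of `X_f`,
so two extensions can differ only off `X_f`. -/
lemma Extends.eqOn {U : Set (Ambient n)} {β : SpacetimeForm f U a} {θ η : Ambient n → Alt n a}
    (hθ : Extends θ β) (hη : Extends η β) : EqOn θ η (f.X ∩ U) := fun y hy =>
  eq_of_eqOn_tangent hy.1 (hθ.2 y hy).1 (hθ.2 y hy).2 (hη.2 y hy).1 (hη.2 y hy).2 fun v =>
    (hθ.1 ⟨y, hy⟩ v).trans (hη.1 ⟨y, hy⟩ v).symm

end Pointwise

/-! ### Lie derivatives along curves and of pull-backs -/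

section LieDerivative

variable {a : ℕ} {V : Ambient n → Ambient n} {U : Set (Ambient n)}

lemma lieDeriv_sub {θ η : Ambient n → Alt n a} {x : Ambient n} (hθ : DifferentiableAt ℝ θ x)
    (hη : DifferentiableAt ℝ η x) (v : Fin a → Ambient n) :
    lieDeriv V (fun z => θ z - η z) x v = lieDeriv V θ x v - lieDeriv V η x v := by
  simp only [lieDeriv]
  rw [fderiv_fun_sub hθ hη]
  simp only [sub_apply, Finset.sum_sub_distrib, ContinuousAlternatingMap.sub_apply]
  ring

/-- Eigenforms of a Lie derivative that vanish at a point vanish along the integral curve through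
that point. -/
lemma JoinedAlong.eq_zero (hU : IsOpen U) (hV : ContDiffOn ℝ ∞ V U) {θ : Ambient n → Alt n a}
    (hθ : ContDiffOn ℝ ∞ θ U) {r : ℝ} (hL : ∀ z ∈ U, ∀ v, lieDeriv V θ z v = r * θ z v)
    {x y : Ambient n} (hxy : JoinedAlong V U x y) (hx : θ x = 0) : θ y = 0 := by
  obtain ⟨γ, c, rfl, rfl, hc, hγ⟩ := hxy
  have hγc : ContinuousOn γ (Icc 0 1) := fun t ht =>
    (hγ t ht).2.continuousAt.continuousWithinAt
  have hVc : ContinuousOn (fun t => fderiv ℝ V (γ t)) (Icc 0 1) :=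
    (hV.continuousOn_fderiv_of_isOpen hU (by simp)).comp hγc fun t ht => (hγ t ht).1
  obtain ⟨C, hC⟩ := isCompact_Icc.exists_bound_of_continuousOn
    (hc.smul (continuousOn_const (c := |r|)))
  obtain ⟨C', hC'⟩ := isCompact_Icc.exists_bound_of_continuousOn (hc.smul hVc)
  have hd : ∀ t ∈ Icc (0 : ℝ) 1, HasDerivAt (fun t => θ (γ t))
      (c t • fderiv ℝ θ (γ t) (V (γ t))) t := by
    intro t ht
    have h1 := ((hθ.contDiffAt (hU.mem_nhds (hγ t ht).1)).differentiableAt (by simp)).hasFDerivAt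
    have h2 := h1.comp_hasDerivAt t (hγ t ht).2
    rwa [map_smul] at h2
  -- Grönwall: the Lie equation expresses `V · θ` linearly in `θ`. `C` bounds the eigenvalue term,
  -- and each of the `a` terms with `DV` is bounded by `C'`.
  refine eq_zero_of_abs_deriv_le_mul_abs_self_of_eq_zero_right (K := C + a * C') (a := 0) (b := 1)
    (fun t ht => (hd t ht).continuousAt.continuousWithinAt)
    (fun t ht => (hd t (Ico_subset_Icc_self ht)).hasDerivWithinAt) hx ?_ 1 (by simp)
  intro t ht'
  have ht := Ico_subset_Icc_self ht'
  have hC0 : 0 ≤ C := (norm_nonneg _).trans (hC t ht)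
  have hC0' : 0 ≤ C' := (norm_nonneg _).trans (hC' t ht)
  refine ContinuousAlternatingMap.opNorm_le_bound _ (by positivity) fun v => ?_
  set A := θ (γ t) with hA
  set M := fderiv ℝ V (γ t) with hM
  have h1 : fderiv ℝ θ (γ t) (V (γ t)) v =
      r * A v - ∑ i, A (Function.update v i (M (v i))) := by
    have := hL (γ t) (hγ t ht).1 v
    rw [lieDeriv] at this
    linarith
  have h2 : (c t • fderiv ℝ θ (γ t) (V (γ t))) v =
      (c t * r) * A v - ∑ i, A (Function.update v i ((c t • M) (v i))) := by
    rw [ContinuousAlternatingMap.smul_apply, h1, smul_eq_mul, mul_sub, Finset.mul_sum, mul_assoc]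
    congr 1
    refine Finset.sum_congr rfl fun i _ => ?_
    rw [smul_apply, A.map_update_smul, smul_eq_mul]
  have hCt : |c t * r| ≤ C := by
    have := hC t ht
    simpa [abs_mul] using this
  have hCt' : ‖c t • M‖ ≤ C' := hC' t ht
  have h3 : ∀ i, ‖A (Function.update v i ((c t • M) (v i)))‖ ≤ C' * (‖A‖ * ∏ i, ‖v i‖) := by
    intro i
    refine (A.le_opNorm _).trans ?_
    rw [mul_left_comm]
    refine mul_le_mul_of_nonneg_left ?_ (norm_nonneg A)
    rw [← Finset.mul_prod_erase Finset.univ _ (Finset.mem_univ i),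
      ← Finset.mul_prod_erase Finset.univ (fun i => ‖v i‖) (Finset.mem_univ i),
      Function.update_self, ← mul_assoc]
    have h4 : ∏ j ∈ Finset.univ.erase i, ‖Function.update v i ((c t • M) (v i)) j‖ =
        ∏ j ∈ Finset.univ.erase i, ‖v j‖ :=
      Finset.prod_congr rfl fun j hj => by
        rw [Function.update_of_ne (Finset.ne_of_mem_erase hj)]
    rw [h4]
    refine mul_le_mul_of_nonneg_right ?_ (Finset.prod_nonneg fun _ _ => norm_nonneg _)
    exact ((c t • M).le_opNorm _).trans (mul_le_mul_of_nonneg_right hCt' (norm_nonneg _))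
  rw [h2]
  calc ‖c t * r * A v - ∑ i, A (Function.update v i ((c t • M) (v i)))‖
      ≤ ‖c t * r * A v‖ + ‖∑ i, A (Function.update v i ((c t • M) (v i)))‖ := norm_sub_le _ _
    _ ≤ C * (‖A‖ * ∏ i, ‖v i‖) + ∑ _i : Fin a, C' * (‖A‖ * ∏ i, ‖v i‖) := by
        refine add_le_add ?_ ((norm_sum_le _ _).trans (Finset.sum_le_sum fun i _ => h3 i))
        rw [norm_mul, Real.norm_eq_abs]
        exact mul_le_mul hCt (A.le_opNorm v) (norm_nonneg _) hC0
    _ = (C + a * C') * ‖A‖ * ∏ i, ‖v i‖ := by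
        rw [Finset.sum_const, Finset.card_univ, Fintype.card_fin, nsmul_eq_mul]
        ring

/-- The Lie derivative, along a vector field tangent to the fibres of `u`, of the pull-back of a
form by `u`, multiplied by a power of an eigenfunction. -/
lemma lieDeriv_rpow_smul_pullback {m : ℕ} (hU : IsOpen U) {u : Ambient n → Fin m → ℝ}
    (hu : ContDiffOn ℝ ∞ u U) {B : Set (Fin m → ℝ)} (hB : IsOpen B) (huB : MapsTo u U B)
    {b : (Fin m → ℝ) → (Fin m → ℝ) [⋀^Fin a]→L[ℝ] ℝ} (hb : ContDiffOn ℝ ∞ b B)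
    {r : Ambient n → ℝ} (hr : ContDiffOn ℝ ∞ r U) (hr0 : ∀ y ∈ U, 0 < r y)
    (hV : ContDiffOn ℝ ∞ V U) (huV : ∀ y ∈ U, fderiv ℝ u y (V y) = 0) {κ : ℝ}
    (hrV : ∀ y ∈ U, fderiv ℝ r y (V y) = κ * r y) {ρ : ℝ} {θ : Ambient n → Alt n a}
    (hθ : ∀ y ∈ U, ∀ v, θ y v = r y ^ ρ * b (u y) fun i => fderiv ℝ u y (v i))
    (hθs : ContDiffOn ℝ ∞ θ U) {y : Ambient n} (hy : y ∈ U) (v : Fin a → Ambient n) :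
    lieDeriv V θ y v = κ * ρ * θ y v := by
  have hyn : U ∈ 𝓝 y := hU.mem_nhds hy
  have hud : ContDiffOn ℝ ∞ (fderiv ℝ u) U := hu.fderiv_of_isOpen hU (by simp)
  have hud' : DifferentiableAt ℝ (fderiv ℝ u) y :=
    (hud.contDiffAt hyn).differentiableAt (by simp)
  have hVd : DifferentiableAt ℝ V y := (hV.contDiffAt hyn).differentiableAt (by simp)
  have hrd : DifferentiableAt ℝ r y := (hr.contDiffAt hyn).differentiableAt (by simp)
  have hu' : DifferentiableAt ℝ u y := (hu.contDiffAt hyn).differentiableAt (by simp)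
  have hb' : DifferentiableAt ℝ b (u y) :=
    (hb.contDiffAt (hB.mem_nhds (huB hy))).differentiableAt (by simp)
  have hθd : DifferentiableAt ℝ θ y := (hθs.contDiffAt hyn).differentiableAt (by simp)
  -- second derivatives of `u`
  have hsymm : ∀ w, fderiv ℝ (fderiv ℝ u) y (V y) w = -fderiv ℝ u y (fderiv ℝ V y w) := by
    intro w
    have h1 : IsSymmSndFDerivAt ℝ u y := (hu.contDiffAt hyn).isSymmSndFDerivAt (by
      rw [minSmoothness_of_isRCLikeNormedField]
      exact WithTop.coe_le_coe.2 (le_top : (2 : ℕ∞) ≤ ⊤))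
    rw [h1.eq]
    have h2 : HasFDerivAt (fun z => fderiv ℝ u z (V z)) (0 : Ambient n →L[ℝ] Fin m → ℝ) y := by
      refine (hasFDerivAt_const 0 y).congr_of_eventuallyEq ?_
      filter_upwards [hyn] with z hz using huV z hz
    have h3 := (hud'.hasFDerivAt.clm_apply hVd.hasFDerivAt).unique h2
    have h4 := DFunLike.congr_fun h3 w
    simp only [add_apply, ContinuousLinearMap.comp_apply,
      ContinuousLinearMap.flip_apply, zero_apply] at h4
    exact eq_neg_of_add_eq_zero_right h4
  set g : Ambient n → ℝ := fun z => b (u z) fun i => fderiv ℝ u z (v i) with hg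
  have hbu : DifferentiableAt ℝ (fun z => b (u z)) y := hb'.comp y hu'
  have hvi : ∀ i, DifferentiableAt ℝ (fun z => fderiv ℝ u z (v i)) y := fun i =>
    hud'.clm_apply (differentiableAt_const _)
  have hgd : DifferentiableAt ℝ g y := hbu.continuousAlternatingMap_apply hvi
  have hdg : fderiv ℝ g y (V y) = -∑ i, b (u y) (Function.update (fun i => fderiv ℝ u y (v i)) i
      (fderiv ℝ u y (fderiv ℝ V y (v i)))) := by
    rw [hg, fderiv_continuousAlternatingMap_apply_apply hbu hvi]
    have h1 : fderiv ℝ (fun z => b (u z)) y (V y) = 0 := by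
      have h2 : HasFDerivAt (fun z => b (u z)) _ y := hb'.hasFDerivAt.comp y hu'.hasFDerivAt
      rw [h2.fderiv, ContinuousLinearMap.comp_apply, huV y hy, map_zero]
    rw [h1, ContinuousAlternatingMap.coe_zero, Pi.zero_apply, zero_add, ← Finset.sum_neg_distrib]
    refine Finset.sum_congr rfl fun i _ => ?_
    have h3 : fderiv ℝ (fun z => fderiv ℝ u z (v i)) y (V y) =
        (-1 : ℝ) • fderiv ℝ u y (fderiv ℝ V y (v i)) := by
      have h4 := hud'.hasFDerivAt.clm_apply (hasFDerivAt_const (v i) y)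
      rw [h4.fderiv, neg_one_smul, ← hsymm]
      simp
    rw [h3, ContinuousAlternatingMap.map_update_smul, neg_one_smul]
  have hdr : fderiv ℝ (fun z => r z ^ ρ) y (V y) = κ * ρ * r y ^ ρ := by
    rw [(hrd.hasFDerivAt.rpow_const (p := ρ) (Or.inl (hr0 y hy).ne')).fderiv, smul_apply,
      hrV y hy, smul_eq_mul, Real.rpow_sub_one (hr0 y hy).ne']
    field_simp [(hr0 y hy).ne']
  have hrpow : DifferentiableAt ℝ (fun z => r z ^ ρ) y :=
    hrd.rpow_const (Or.inl (hr0 y hy).ne')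
  have hdθ : fderiv ℝ θ y (V y) v = κ * ρ * r y ^ ρ * g y + r y ^ ρ * fderiv ℝ g y (V y) := by
    rw [← fderiv_continuousAlternatingMap_apply_const_apply hθd]
    have h1 : (fun z => θ z v) =ᶠ[𝓝 y] fun z => r z ^ ρ * g z := by
      filter_upwards [hyn] with z hz using hθ z hz v
    rw [h1.fderiv_eq, fderiv_fun_mul hrpow hgd]
    simp only [add_apply, smul_apply, smul_eq_mul, hdr]
    ring
  have hsum : ∀ i, θ y (Function.update v i (fderiv ℝ V y (v i))) =
      r y ^ ρ * b (u y) (Function.update (fun i => fderiv ℝ u y (v i)) i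
        (fderiv ℝ u y (fderiv ℝ V y (v i)))) := by
    intro i
    rw [hθ y hy]
    congr 2
    funext j
    rcases eq_or_ne j i with rfl | hj
    · simp
    · simp [hj]
  rw [lieDeriv, hdθ, hdg, Finset.sum_congr rfl fun i _ => hsum i, ← Finset.mul_sum, hθ y hy]
  ring

end LieDerivative

end NullConeForms

/-! ### Extensions on a flow box -/

namespace NullConeForms

variable {n a : ℕ} {f : DefiningFunction n} {V : Ambient n → Ambient n} {U : Set (Ambient n)}

lemma contDiff_dilation : ContDiff ℝ ∞ (dilation (n := n)) := contDiff_id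

namespace FlowBox

/-- Homogeneous invariant forms on a flow box are determined by their values along `X_f`. -/
theorem eqOn (hV : ContDiffOn ℝ ∞ V f.domain) (box : FlowBox f V U) {r : ℝ}
    {θ η : Ambient n → Alt n a} (hθ : ContDiffOn ℝ ∞ θ U) (hη : ContDiffOn ℝ ∞ η U)
    (hθD : IsHomogeneousOn U r θ) (hηD : IsHomogeneousOn U r η) (hθV : IsInvariantOn V U θ)
    (hηV : IsInvariantOn V U η) (h : EqOn θ η (f.X ∩ U)) : EqOn θ η U := by
  intro y hy
  obtain ⟨x, hx, z, hz, hxz, hzy⟩ := box.joined y hy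
  have hsub : ContDiffOn ℝ ∞ (fun z => θ z - η z) U := hθ.sub hη
  have hlie : ∀ W : Ambient n → Ambient n, ∀ s : ℝ, (∀ z ∈ U, ∀ v, lieDeriv W θ z v = s * θ z v) →
      (∀ z ∈ U, ∀ v, lieDeriv W η z v = s * η z v) →
      ∀ z ∈ U, ∀ v, lieDeriv W (fun z => θ z - η z) z v = s * (θ z - η z) v := by
    intro W s h1 h2 z hz v
    have hzn := box.isOpen.mem_nhds hz
    rw [lieDeriv_sub ((hθ.contDiffAt hzn).differentiableAt (by simp))
      ((hη.contDiffAt hzn).differentiableAt (by simp)), h1 z hz, h2 z hz,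
      ContinuousAlternatingMap.sub_apply, mul_sub]
  have h1 : θ z - η z = 0 := hxz.eq_zero box.isOpen contDiff_dilation.contDiffOn hsub
    (hlie _ r hθD hηD) (sub_eq_zero.2 (h hx))
  have h2 : θ y - η y = 0 := hzy.eq_zero box.isOpen (hV.mono box.subset_domain) hsub (r := 0)
    (hlie _ 0 (fun z hz v => by rw [hθV z hz v, zero_mul])
      (fun z hz v => by rw [hηV z hz v, zero_mul])) h1
  exact sub_eq_zero.1 h2

variable (box : FlowBox f V U) (β : SpacetimeForm f U a)

lemma fderiv_σ_mem_tangent {x : Fin n → ℝ} (hx : x ∈ box.B) (w : Fin n → ℝ) :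
    fderiv ℝ box.σ x w ∈ f.tangent (box.σ x) :=
  fderiv_mem_tangent box.isOpen_B box.contDiffOn_σ (fun _ hz => (box.mapsTo_σ hz).1) hx w

open Classical in
/-- The pull-back of a form on `X_f ∩ U` to the parameter domain of a flow box. -/
def chartForm (x : Fin n → ℝ) : (Fin n → ℝ) [⋀^Fin a]→L[ℝ] ℝ :=
  if hx : x ∈ box.B then
    (β.toFun ⟨box.σ x, box.mapsTo_σ hx⟩).compContinuousLinearMap
      ((fderiv ℝ box.σ x).codRestrict (f.tangent (box.σ x)) (box.fderiv_σ_mem_tangent hx))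
  else 0

lemma chartForm_apply {x : Fin n → ℝ} (hx : x ∈ box.B) (w : Fin a → Fin n → ℝ) :
    box.chartForm β x w = β.toFun ⟨box.σ x, box.mapsTo_σ hx⟩
      fun i => ⟨fderiv ℝ box.σ x (w i), box.fderiv_σ_mem_tangent hx (w i)⟩ := by
  rw [chartForm, dif_pos hx]
  rfl

/-- The parametrisation `σ` is itself one of the test maps in the definition of smoothness on `X_f`.
-/
lemma contDiffOn_chartForm : ContDiffOn ℝ ∞ (box.chartForm β) box.B := by
  refine contDiffOn_alternating fun w => ?_
  obtain ⟨g, hg, hgβ⟩ := β.smooth box.B box.σ box.isOpen_B box.contDiffOn_σ box.mapsTo_σ w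
  exact hg.congr fun x hx => (box.chartForm_apply β hx w).trans (hgβ x hx).symm

open Classical in
/-- The extension of a form on `X_f ∩ U` to a flow box. -/
def extension (ρ : ℝ) : AmbientForm n U a where
  toFun y := if y ∈ U then
    box.r y ^ ρ • (box.chartForm β (box.u y)).compContinuousLinearMap (fderiv ℝ box.u y) else 0
  smooth := by
    have hdu : ContDiffOn ℝ ∞ (fderiv ℝ box.u) U :=
      box.contDiffOn_u.fderiv_of_isOpen box.isOpen (by simp)
    refine contDiffOn_alternating fun v => ?_
    have h1 : ContDiffOn ℝ ∞ (fun y => box.r y ^ ρ *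
        box.chartForm β (box.u y) fun i => fderiv ℝ box.u y (v i)) U := by
      refine ContDiffOn.mul ?_ ?_
      · exact box.contDiffOn_r.rpow_const_of_ne fun y hy => (box.r_pos y hy).ne'
      · exact contDiffOn_alternating_apply
          ((box.contDiffOn_chartForm β).comp box.contDiffOn_u box.mapsTo_u)
          fun i => hdu.clm_apply contDiffOn_const
    refine h1.congr fun y hy => ?_
    rw [if_pos hy]
    rfl
  eq_zero_off x hx := if_neg hx

lemma extension_apply (ρ : ℝ) {y : Ambient n} (hy : y ∈ U) (v : Fin a → Ambient n) :
    (box.extension β ρ).toFun y v =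
      box.r y ^ ρ * box.chartForm β (box.u y) fun i => fderiv ℝ box.u y (v i) := by
  simp only [extension]
  rw [if_pos hy]
  rfl

/-- On `X_f` the factor `r ^ ρ` is 1, `σ ∘ u` fixes the point and its differential fixes tangent
vectors. -/
lemma pullsBackTo_extension (ρ : ℝ) : PullsBackTo (box.extension β ρ).toFun β := by
  intro y v
  rw [box.extension_apply β ρ y.2.2, box.r_of_mem y y.2, Real.one_rpow, one_mul,
    box.chartForm_apply β (box.mapsTo_u y.2.2)]
  exact β.apply_congr (Subtype.ext (box.σ_u y y.2)) fun i =>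
    box.fderiv_σ_fderiv_u y y.2 _ (v i).2

/-- `du` annihilates `D` and `V`, hence also `F`, since `f` has no zero in the box. -/
lemma isTransverseOn_extension (hspan : ∀ y ∈ f.domain, f.toFun y ≠ 0 →
    ∃ p q : ℝ, f.F y = p • y + q • V y) (ρ : ℝ) :
    IsTransverseOn f U (box.extension β ρ).toFun := by
  intro y hy
  have key : ∀ w, fderiv ℝ box.u y w = 0 → interior w ((box.extension β ρ).toFun y) = 0 := by
    intro w hw
    refine interior_eq_zero fun v i hi => ?_
    rw [box.extension_apply β ρ hy, (box.chartForm β (box.u y)).map_coord_zero i (by rw [hi, hw]),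
      mul_zero]
  refine ⟨key _ (box.fderiv_u_self y hy), key _ ?_⟩
  obtain ⟨p, q, hpq⟩ := hspan y (box.subset_domain hy) (box.ne_zero y hy)
  rw [hpq, map_add, map_smul, map_smul, box.fderiv_u_self y hy, box.fderiv_u_V y hy]
  simp

lemma isHomogeneousOn_extension (ρ : ℝ) : IsHomogeneousOn U ρ (box.extension β ρ).toFun := by
  intro y hy v
  have h := lieDeriv_rpow_smul_pullback box.isOpen box.contDiffOn_u box.isOpen_B box.mapsTo_u
    (box.contDiffOn_chartForm β) box.contDiffOn_r box.r_pos contDiff_dilation.contDiffOn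
    box.fderiv_u_self (κ := 1) (fun y hy => (box.fderiv_r_self y hy).trans (one_mul _).symm)
    (fun y hy v => box.extension_apply β ρ hy v) (box.extension β ρ).smooth hy v
  rwa [one_mul] at h

lemma isInvariantOn_extension (hV : ContDiffOn ℝ ∞ V f.domain) (ρ : ℝ) :
    IsInvariantOn V U (box.extension β ρ).toFun := by
  intro y hy v
  have h := lieDeriv_rpow_smul_pullback box.isOpen box.contDiffOn_u box.isOpen_B box.mapsTo_u
    (box.contDiffOn_chartForm β) box.contDiffOn_r box.r_pos (hV.mono box.subset_domain)
    box.fderiv_u_V (κ := 0) (fun y hy => (box.fderiv_r_V y hy).trans (zero_mul _).symm)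
    (fun y hy v => box.extension_apply β ρ hy v) (box.extension β ρ).smooth hy v
  rwa [zero_mul, zero_mul] at h

lemma isStronglyTransverseOn_extension {d : ℕ} (hV : f.IsTransversal V d) (ρ : ℝ) :
    IsStronglyTransverseOn f V U ρ (box.extension β ρ).toFun :=
  ⟨box.isTransverseOn_extension β hV.F_mem_span ρ, box.isHomogeneousOn_extension β ρ,
    box.isInvariantOn_extension β hV.smooth ρ⟩

end FlowBox

lemma IsTransverseOn.mono {S S' : Set (Ambient n)} (h : S ⊆ S') {θ : Ambient n → Alt n a}
    (hθ : IsTransverseOn f S' θ) : IsTransverseOn f S θ := fun x hx => hθ x (h hx)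

lemma pullsBackTo_pullback (θ : AmbientForm n U a) : PullsBackTo θ.toFun (pullback f θ) :=
  fun _ _ => rfl

lemma PullsBackTo.eq_pullback {θ : AmbientForm n U a} {β : SpacetimeForm f U a}
    (h : PullsBackTo θ.toFun β) : pullback f θ = β :=
  SpacetimeForm.ext fun y v => h y v

/-- The local correspondence between forms on `X_f` and their extensions, on a flow box. -/
theorem FlowBox.extension_correspondence {d : ℕ} (hV : f.IsTransversal V d) (box : FlowBox f V U)
    (a : ℕ) (r : ℝ) :
    (∀ β : SpacetimeForm f U a,
      (∃! θ : AmbientForm n U a, Extends θ.toFun β ∧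
        IsHomogeneousOn U r θ.toFun ∧ IsInvariantOn V U θ.toFun) ∧
      ∀ θ : AmbientForm n U a, Extends θ.toFun β → IsHomogeneousOn U r θ.toFun →
        IsInvariantOn V U θ.toFun → IsTransverseOn f U θ.toFun) ∧
    Function.Bijective
      (fun θ : {θ : AmbientForm n U a // IsStronglyTransverseOn f V U r θ.toFun} =>
        pullback f θ.1) := by
  have huniq : ∀ (β : SpacetimeForm f U a) (θ η : AmbientForm n U a), Extends θ.toFun β →
      IsHomogeneousOn U r θ.toFun → IsInvariantOn V U θ.toFun → Extends η.toFun β →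
      IsHomogeneousOn U r η.toFun → IsInvariantOn V U η.toFun → θ = η := by
    intro β θ η hθ hθD hθV hη hηD hηV
    exact AmbientForm.ext_of_eqOn
      (box.eqOn hV.smooth θ.smooth η.smooth hθD hηD hθV hηV (hθ.eqOn hη))
  have hext : ∀ β : SpacetimeForm f U a, Extends (box.extension β r).toFun β := fun β =>
    ⟨box.pullsBackTo_extension β r,
      (box.isStronglyTransverseOn_extension β hV r).1.mono inter_subset_right⟩
  refine ⟨fun β => ?_, ?_, ?_⟩
  · obtain ⟨hT, hD, hI⟩ := box.isStronglyTransverseOn_extension β hV r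
    refine ⟨⟨box.extension β r, ⟨hext β, hD, hI⟩, fun θ hθ => ?_⟩, fun θ h1 h2 h3 => ?_⟩
    · exact huniq β θ _ hθ.1 hθ.2.1 hθ.2.2 (hext β) hD hI
    · rw [huniq β θ _ h1 h2 h3 (hext β) hD hI]
      exact hT
  · rintro ⟨θ, hT, hD, hI⟩ ⟨η, hT', hD', hI'⟩ h
    have h' : pullback f θ = pullback f η := h
    refine Subtype.ext (huniq (pullback f θ) θ η
      ⟨pullsBackTo_pullback θ, hT.mono inter_subset_right⟩ hD hI ?_ hD' hI')
    rw [h']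
    exact ⟨pullsBackTo_pullback η, hT'.mono inter_subset_right⟩
  · intro β
    exact ⟨⟨box.extension β r, box.isStronglyTransverseOn_extension β hV r⟩,
      (box.pullsBackTo_extension β r).eq_pullback⟩

/-! ### Gluing and uniqueness near the whole of `X_f` -/

/-- Lie derivatives only depend on germs. -/
lemma lieDeriv_congr {θ η : Ambient n → Alt n a} {x : Ambient n} (h : θ =ᶠ[𝓝 x] η)
    (v : Fin a → Ambient n) : lieDeriv V θ x v = lieDeriv V η x v := by
  rw [lieDeriv, lieDeriv, h.fderiv_eq, h.eq_of_nhds]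

open Classical in
/-- Forms on `X_f` extend to a neighbourhood of `X_f`. -/
theorem DefiningFunction.exists_extension {d : ℕ} (hV : f.IsTransversal V d) (r : ℝ)
    (β : SpacetimeForm f univ a) :
    ∃ W : Set (Ambient n), IsOpen W ∧ f.X ⊆ W ∧ W ⊆ f.domain ∧ ∃ θ : AmbientForm n W a,
      IsStronglyTransverseOn f V W r θ.toFun ∧ PullsBackTo θ.toFun β := by
  have hbox : ∀ x : f.X, ∃ U : Set (Ambient n), (x : Ambient n) ∈ U ∧ Nonempty (FlowBox f V U) := by
    intro x
    obtain ⟨U, hxU, -, hU⟩ := f.exists_flowBox hV x.2 univ_mem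
    exact ⟨U, hxU, hU⟩
  choose U hxU hU using hbox
  let box : ∀ x : f.X, FlowBox f V (U x) := fun x => (hU x).some
  let Θ : ∀ x : f.X, AmbientForm n (U x) a := fun x =>
    (box x).extension (β.restrict (subset_univ (U x))) r
  have hΘ : ∀ x, IsStronglyTransverseOn f V (U x) r (Θ x).toFun := fun x =>
    (box x).isStronglyTransverseOn_extension _ hV r
  have hΘβ : ∀ x, PullsBackTo (Θ x).toFun (β.restrict (subset_univ (U x))) := fun x =>
    (box x).pullsBackTo_extension _ r
  -- The overlap of two boxes need not be a flow box, so uniqueness cannot be applied to it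
  -- directly. If instead boxes `U'` of radius `ρ` meet and `ρ z ≤ ρ x`, the factor 3 puts all of
  -- `U' z` inside `U x`, and uniqueness applies on the box `U' z`.
  have hrad : ∀ x : f.X, ∃ ρ > 0, Metric.ball (x : Ambient n) (3 * ρ) ⊆ U x := by
    intro x
    obtain ⟨ε, hε, h⟩ := Metric.isOpen_iff.1 (box x).isOpen x (hxU x)
    exact ⟨ε / 3, by positivity, by rwa [mul_div_cancel₀ _ (by norm_num : (3 : ℝ) ≠ 0)]⟩
  choose ρ hρ hρU using hrad
  have hbox' : ∀ x : f.X, ∃ U' : Set (Ambient n), (x : Ambient n) ∈ U' ∧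
      U' ⊆ Metric.ball (x : Ambient n) (ρ x) ∧ Nonempty (FlowBox f V U') := fun x =>
    f.exists_flowBox hV x.2 (Metric.ball_mem_nhds _ (hρ x))
  choose U' hxU' hU'ρ hU' using hbox'
  have hU'U : ∀ x, U' x ⊆ U x := fun x y hy => hρU x
    (Metric.ball_subset_ball (by linarith [hρ x]) (hU'ρ x hy))
  have hcomp : ∀ x z : f.X, ρ z ≤ ρ x → ∀ y ∈ U' x, y ∈ U' z → (Θ x).toFun y = (Θ z).toFun y := by
    intro x z hzx y hyx hyz
    have hsub : U' z ⊆ U x := by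
      intro p hp
      refine hρU x (Metric.mem_ball.2 ?_)
      have h1 := Metric.mem_ball.1 (hU'ρ z hp)
      have h2 := Metric.mem_ball.1 (hU'ρ z hyz)
      have h3 := Metric.mem_ball.1 (hU'ρ x hyx)
      have h4 := dist_triangle4 p z y (x : Ambient n)
      rw [dist_comm (z : Ambient n) y] at h4
      linarith
    obtain ⟨bz⟩ := hU' z
    refine bz.eqOn hV.smooth ((Θ x).smooth.mono hsub) ((Θ z).smooth.mono (hU'U z))
      (fun p hp => (hΘ x).2.1 p (hsub hp)) (fun p hp => (hΘ z).2.1 p (hU'U z hp))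
      (fun p hp => (hΘ x).2.2 p (hsub hp)) (fun p hp => (hΘ z).2.2 p (hU'U z hp)) ?_ hyz
    have e1 : Extends (Θ x).toFun (β.restrict (subset_univ (U' z))) :=
      ⟨fun p v => hΘβ x ⟨p, p.2.1, hsub p.2.2⟩ v,
        (hΘ x).1.mono (inter_subset_right.trans hsub)⟩
    have e2 : Extends (Θ z).toFun (β.restrict (subset_univ (U' z))) :=
      ⟨fun p v => hΘβ z ⟨p, p.2.1, hU'U z p.2.2⟩ v,
        (hΘ z).1.mono (inter_subset_right.trans (hU'U z))⟩
    exact e1.eqOn e2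
  have hagree : ∀ x z : f.X, ∀ y ∈ U' x, y ∈ U' z → (Θ x).toFun y = (Θ z).toFun y := by
    intro x z y hyx hyz
    rcases le_total (ρ z) (ρ x) with h | h
    · exact hcomp x z h y hyx hyz
    · exact (hcomp z x h y hyz hyx).symm
  have hU'o : ∀ x, IsOpen (U' x) := fun x => (hU' x).some.isOpen
  set θ : Ambient n → Alt n a := fun y =>
    if h : ∃ x, y ∈ U' x then (Θ h.choose).toFun y else 0 with hθ
  have hθΘ : ∀ x, EqOn θ (Θ x).toFun (U' x) := by
    intro x y hy
    have h : ∃ x, y ∈ U' x := ⟨x, hy⟩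
    rw [hθ]
    dsimp only
    rw [dif_pos h]
    exact hagree _ x y h.choose_spec hy
  have hθe : ∀ x, ∀ y ∈ U' x, θ =ᶠ[𝓝 y] (Θ x).toFun := fun x y hy =>
    eventuallyEq_of_mem ((hU'o x).mem_nhds hy) (hθΘ x)
  refine ⟨⋃ x, U' x, isOpen_iUnion hU'o, fun x hx => mem_iUnion.2 ⟨⟨x, hx⟩, hxU' ⟨x, hx⟩⟩,
    iUnion_subset fun x => (hU'U x).trans (box x).subset_domain, ⟨θ, ?_, ?_⟩, ⟨?_, ?_, ?_⟩, ?_⟩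
  · intro y hy
    obtain ⟨x, hx⟩ := mem_iUnion.1 hy
    have h1 : ContDiffAt ℝ ∞ (Θ x).toFun y :=
      (Θ x).smooth.contDiffAt ((box x).isOpen.mem_nhds (hU'U x hx))
    exact (h1.congr_of_eventuallyEq (hθe x y hx)).contDiffWithinAt
  · intro y hy
    exact dif_neg fun h => hy (mem_iUnion.2 h)
  · intro y hy
    obtain ⟨x, hx⟩ := mem_iUnion.1 hy
    dsimp only
    rw [hθΘ x hx]
    exact (hΘ x).1 y (hU'U x hx)
  · intro y hy v
    obtain ⟨x, hx⟩ := mem_iUnion.1 hy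
    dsimp only
    rw [lieDeriv_congr (hθe x y hx), hθΘ x hx]
    exact (hΘ x).2.1 y (hU'U x hx) v
  · intro y hy v
    obtain ⟨x, hx⟩ := mem_iUnion.1 hy
    rw [lieDeriv_congr (hθe x y hx)]
    exact (hΘ x).2.2 y (hU'U x hx) v
  · intro y v
    dsimp only
    rw [hθΘ ⟨y, y.2.1⟩ (hxU' ⟨y, y.2.1⟩)]
    exact hΘβ ⟨y, y.2.1⟩ ⟨y, y.2.1, hxU ⟨y, y.2.1⟩⟩ v

/-- Extensions of forms on `X_f` are unique near `X_f`. -/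
theorem DefiningFunction.extension_unique {d : ℕ} (hV : f.IsTransversal V d) {r : ℝ}
    {β : SpacetimeForm f univ a} {W₁ W₂ : Set (Ambient n)} (hW₁ : IsOpen W₁) (hX₁ : f.X ⊆ W₁)
    (hW₂ : IsOpen W₂) (hX₂ : f.X ⊆ W₂) {θ₁ θ₂ : Ambient n → Alt n a}
    (hs₁ : ContDiffOn ℝ ∞ θ₁ W₁) (hs₂ : ContDiffOn ℝ ∞ θ₂ W₂)
    (he₁ : Extends θ₁ β) (hD₁ : IsHomogeneousOn W₁ r θ₁) (hI₁ : IsInvariantOn V W₁ θ₁)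
    (he₂ : Extends θ₂ β) (hD₂ : IsHomogeneousOn W₂ r θ₂) (hI₂ : IsInvariantOn V W₂ θ₂) :
    ∃ W : Set (Ambient n), IsOpen W ∧ f.X ⊆ W ∧ W ⊆ W₁ ∩ W₂ ∧ EqOn θ₁ θ₂ W := by
  have hbox : ∀ x : f.X, ∃ U : Set (Ambient n), (x : Ambient n) ∈ U ∧ U ⊆ W₁ ∩ W₂ ∧
      Nonempty (FlowBox f V U) := fun x =>
    f.exists_flowBox hV x.2 ((hW₁.inter hW₂).mem_nhds ⟨hX₁ x.2, hX₂ x.2⟩)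
  choose U hxU hUW hU using hbox
  -- Both forms are defined on each of these boxes, so uniqueness box by box suffices and overlaps
  -- play no role.
  refine ⟨⋃ x, U x, isOpen_iUnion fun x => (hU x).some.isOpen,
    fun x hx => mem_iUnion.2 ⟨⟨x, hx⟩, hxU ⟨x, hx⟩⟩, iUnion_subset hUW, ?_⟩
  intro y hy
  obtain ⟨x, hx⟩ := mem_iUnion.1 hy
  have h1 : U x ⊆ W₁ := (hUW x).trans inter_subset_left
  have h2 : U x ⊆ W₂ := (hUW x).trans inter_subset_right
  exact (hU x).some.eqOn hV.smooth (hs₁.mono h1) (hs₂.mono h2) (fun p hp => hD₁ p (h1 hp))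
    (fun p hp => hD₂ p (h2 hp)) (fun p hp => hI₁ p (h1 hp)) (fun p hp => hI₂ p (h2 hp))
    ((he₁.eqOn he₂).mono (inter_subset_inter_right _ (subset_univ _))) hx

end NullConeForms

end

open NullConeForms in
theorem mainTheorem9 (n : ℕ) (f : DefiningFunction n)
    (V : Ambient n → Ambient n) (hV : V = f.E ∨ V = f.F) :
    -- arbitrarily small neighbourhoods `U` of each point of `X_f`, independent of the forms
    (∀ x₀ ∈ f.X, ∀ N ∈ 𝓝 x₀, ∃ U : Set (Ambient n),
      IsOpen U ∧ x₀ ∈ U ∧ U ⊆ N ∧ U ⊆ f.domain ∧ ∀ (a : ℕ) (r : ℝ),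
        (∀ β : SpacetimeForm f U a,
          (∃! θ : AmbientForm n U a, Extends θ.toFun β ∧
            IsHomogeneousOn U r θ.toFun ∧ IsInvariantOn V U θ.toFun) ∧
          ∀ θ : AmbientForm n U a, Extends θ.toFun β → IsHomogeneousOn U r θ.toFun →
            IsInvariantOn V U θ.toFun → IsTransverseOn f U θ.toFun) ∧
        Function.Bijective
          (fun θ : {θ : AmbientForm n U a // IsStronglyTransverseOn f V U r θ.toFun} =>
            pullback f θ.1)) ∧
    -- neighbourhoods `W` of the whole of `X_f`, with uniqueness of germs along `X_f`
    (∀ (a : ℕ) (r : ℝ) (β : SpacetimeForm f univ a),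
      (∃ W : Set (Ambient n), IsOpen W ∧ f.X ⊆ W ∧ W ⊆ f.domain ∧ ∃ θ : AmbientForm n W a,
        IsStronglyTransverseOn f V W r θ.toFun ∧ PullsBackTo θ.toFun β) ∧
      (∀ W₁ W₂ : Set (Ambient n),
        IsOpen W₁ → f.X ⊆ W₁ → W₁ ⊆ f.domain → IsOpen W₂ → f.X ⊆ W₂ → W₂ ⊆ f.domain →
        ∀ (θ₁ : AmbientForm n W₁ a) (θ₂ : AmbientForm n W₂ a),
          Extends θ₁.toFun β → IsHomogeneousOn W₁ r θ₁.toFun → IsInvariantOn V W₁ θ₁.toFun →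
          Extends θ₂.toFun β → IsHomogeneousOn W₂ r θ₂.toFun → IsInvariantOn V W₂ θ₂.toFun →
          ∃ W : Set (Ambient n), IsOpen W ∧ f.X ⊆ W ∧ W ⊆ W₁ ∩ W₂ ∧
            EqOn θ₁.toFun θ₂.toFun W)) := by
  -- The two fields are distinguished only here; everything else works for any transversal field.
  obtain ⟨d, hT⟩ : ∃ d, f.IsTransversal V d := by
    rcases hV with rfl | rfl
    exacts [⟨1, f.isTransversal_E⟩, ⟨0, f.isTransversal_F⟩]
  refine ⟨fun x₀ hx₀ N hN => ?_, fun a r β => ⟨f.exists_extension hT r β, ?_⟩⟩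
  · obtain ⟨U, hxU, hUN, ⟨box⟩⟩ := f.exists_flowBox hT hx₀ hN
    exact ⟨U, box.isOpen, hxU, hUN, box.subset_domain, box.extension_correspondence hT⟩
  · intro W₁ W₂ hW₁ hX₁ _ hW₂ hX₂ _ θ₁ θ₂ he₁ hD₁ hI₁ he₂ hD₂ hI₂
    exact f.extension_unique hT hW₁ hX₁ hW₂ hX₂ θ₁.smooth θ₂.smooth he₁ hD₁ hI₁ he₂ hD₂ hI₂
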